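/- Let $X\subset\mathbb{R}^n$ be convex and compact, let $g$ be a real-valued function that is smooth ($C^\infty$) on a neighbourhood of $X\times\mathbb{R}^m$, let $Y,Y'\subset\mathbb{R}^m$ be compact with $Y\subset\operatorname{int}Y'$, and let $y_0\in Y$. Assume that on $X\times\mathbb{R}^m$ the gradient $\nabla g$ is Lipschitz, $\nabla^2_{yy}g$ is Lipschitz (Euclidean norm on $\mathbb{R}^{n+m}$, operator norm on matrices) with constant $\overline{\overline{L}}_g>0$, and $g$ is bounded below, and that for every $x\in X$ the set $\{y: g(x,y)\le g(x,y_0)\}$ is compact and contained in $Y$. Call $(x,y)$ a stationary point if $\nabla_y g(x,y)=0$, and degenerate if moreover $\det\nabla^2_{yy}g(x,y)=0$. The bifurcation set is $\widetilde{X}=\{x\in X:\ g(x,\cdot)\text{ has a degenerate stationary point}\}$, and $\widetilde{X}_\delta=\{x\in X:\operatorname{dist}(x,\widetilde{X})\le\delta\}$, with $\operatorname{dist}(x,\emptyset)=\infty$. For $r\geq 0$ let $\mathrm{Crit}(x)=\{y\in Y':\nabla_y g(x,y)=0\}$ and $\mathrm{Crit}_r(x)=\{y\in\mathbb{R}^m:\operatorname{dist}(y,\mathrm{Crit}(x))\le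 r\}$. Define, with $\inf\emptyset=\infty$ (and $\mathrm{Crit}_\infty(x)=\mathbb{R}^m$), $$\mu(\delta)=\inf\{|\lambda|:\ x\in X\setminus\widetilde{X}_\delta,\ y\in\mathrm{Crit}(x),\ \lambda\text{ an eigenvalue of }\nabla^2_{yy}g(x,y)\},$$ $$\alpha(\delta,r)=\inf\{\|\nabla_y g(x,y)\|:\ x\in X\setminus\widetilde{X}_\delta,\ y\in Y\setminus\mathrm{Crit}_r(x)\}.$$ Suppose that every degenerate stationary point $(\bar x,\bar y)$ with $\bar x\in X$ is a fold: $0$ is a simple eigenvalue of $\nabla^2_{yy}g(\bar x,\bar y)$ and, for a corresponding unit eigenvector $v$, the vector $w:=\nabla_x\big(\nabla_y g(x,y)^\top v\big)\big|_{(\bar x,\bar y)}$ is nonzero and $\nabla^3_{yyy}g(\bar x,\bar y)[v,v,v]\neq0$. Suppose also that, whenever $\bar x$ lies on the boundary of $X$, the hyperplane $\{x: w^\top(x-\bar x)=0\}$ is not tangent to $X$ at $\bar x$, in the sense that either $w^\top(x-\bar x)$ takes both positive and negative values for $x\in X$, or there is $c>0$ with $|w^\top(x-\bar x)|\ge c\|x-\bar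 x\|$ for all $x\in X$. Then there are constants $D_1,D_2,D_3,D_4>0$ such that for all $\delta>0$ $$\mu(\delta)\ \ge\ \min\{D_1\sqrt{\delta},\,D_2\},\qquad \alpha\!\left(\delta,\frac{\mu(\delta)}{2\overline{\overline{L}}_g}\right)\ \ge\ \min\{D_3\,\delta,\,D_4\}.$$ In words, Hessian eigenvalues at stationary points decay at most like the square root of the distance to the bifurcation set, and gradient lower bounds decay at most linearly. -/

import Mathlib

open scoped ContDiff

namespace FoldBifurcation

noncomputable section

variable {n m : ℕ}

/-- The partial gradient `∇_x g(x, y)`. -/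
def gradX (g : EuclideanSpace ℝ (Fin n) → EuclideanSpace ℝ (Fin m) → ℝ)
    (x : EuclideanSpace ℝ (Fin n)) (y : EuclideanSpace ℝ (Fin m)) : EuclideanSpace ℝ (Fin n) :=
  gradient (fun x' => g x' y) x

/-- The partial gradient `∇_y g(x, y)`. -/
def gradY (g : EuclideanSpace ℝ (Fin n) → EuclideanSpace ℝ (Fin m) → ℝ)
    (x : EuclideanSpace ℝ (Fin n)) (y : EuclideanSpace ℝ (Fin m)) : EuclideanSpace ℝ (Fin m) :=
  gradient (fun y' => g x y') y

/-- The partial Hessian `∇²_yy g(x, y)`, as the derivative in `y` of `∇_y g(x, ·)`. -/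
def hessYY (g : EuclideanSpace ℝ (Fin n) → EuclideanSpace ℝ (Fin m) → ℝ)
    (x : EuclideanSpace ℝ (Fin n)) (y : EuclideanSpace ℝ (Fin m)) :
    EuclideanSpace ℝ (Fin m) →L[ℝ] EuclideanSpace ℝ (Fin m) :=
  fderiv ℝ (fun y' => gradY g x y') y

/-- `y` is a degenerate stationary point of `g(x, ·)`. -/
def IsDegenerateStationary (g : EuclideanSpace ℝ (Fin n) → EuclideanSpace ℝ (Fin m) → ℝ)
    (x : EuclideanSpace ℝ (Fin n)) (y : EuclideanSpace ℝ (Fin m)) : Prop :=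
  gradY g x y = 0 ∧ (hessYY g x y).det = 0

/-- `g(x, ·)` is a Morse function: all its stationary points are nondegenerate. -/
def IsMorse (g : EuclideanSpace ℝ (Fin n) → EuclideanSpace ℝ (Fin m) → ℝ)
    (x : EuclideanSpace ℝ (Fin n)) : Prop :=
  ∀ y, gradY g x y = 0 → (hessYY g x y).det ≠ 0

/-- The bifurcation point set: all `x ∈ X` for which `g(x, ·)` is not Morse. -/
def bifurcationSet (g : EuclideanSpace ℝ (Fin n) → EuclideanSpace ℝ (Fin m) → ℝ)
    (X : Set (EuclideanSpace ℝ (Fin n))) : Set (EuclideanSpace ℝ (Fin n)) :=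
  {x ∈ X | ¬ IsMorse g x}

/-- The points of `X` at distance at most `δ` from the bifurcation set (no points at all when the
bifurcation set is empty, the distance to the empty set being infinite). -/
def bifurcationNhd (g : EuclideanSpace ℝ (Fin n) → EuclideanSpace ℝ (Fin m) → ℝ)
    (X : Set (EuclideanSpace ℝ (Fin n))) (δ : ℝ) : Set (EuclideanSpace ℝ (Fin n)) :=
  X ∩ Metric.cthickening δ (bifurcationSet g X)

/-- The vector `∇_x (∇_y g(x, y)ᵀ v)`. -/
def crossGrad (g : EuclideanSpace ℝ (Fin n) → EuclideanSpace ℝ (Fin m) → ℝ)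
    (x : EuclideanSpace ℝ (Fin n)) (y v : EuclideanSpace ℝ (Fin m)) :
    EuclideanSpace ℝ (Fin n) :=
  gradient (fun x' => inner ℝ (gradY g x' y) v) x

/-- `x` is a fold bifurcation point associated with the stationary point `y`. -/
structure IsFold (g : EuclideanSpace ℝ (Fin n) → EuclideanSpace ℝ (Fin m) → ℝ)
    (x : EuclideanSpace ℝ (Fin n)) (y : EuclideanSpace ℝ (Fin m)) : Prop where
  contDiffAt : ContDiffAt ℝ 3 (Function.uncurry g) (x, y)
  stationary : gradY g x y = 0
  /-- Zero is a simple eigenvalue of the Hessian. -/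
  simple_zero : Module.finrank ℝ (LinearMap.ker (hessYY g x y).toLinearMap) = 1
  cross_ne_zero : ∀ v, ‖v‖ = 1 → hessYY g x y v = 0 → crossGrad g x y v ≠ 0
  third_ne_zero : ∀ v, ‖v‖ = 1 → hessYY g x y v = 0 →
    iteratedFDeriv ℝ 3 (fun y' => g x y') y (fun _ => v) ≠ 0

/-- The hyperplane through `x` with normal `w = ∇_x (∇_y g(x, y)ᵀ v)`, `v` a unit vector in the
kernel of the Hessian, is not tangent to `X` at `x`: there are points of `X` strictly on both of
its sides, or it meets `X` only at `x` and at a nonzero angle.  When `x` is an interior point of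
`X` the first alternative only says that `w ≠ 0`. -/
def NotTangent (g : EuclideanSpace ℝ (Fin n) → EuclideanSpace ℝ (Fin m) → ℝ)
    (X : Set (EuclideanSpace ℝ (Fin n)))
    (x : EuclideanSpace ℝ (Fin n)) (y : EuclideanSpace ℝ (Fin m)) : Prop :=
  ∀ v, ‖v‖ = 1 → hessYY g x y v = 0 →
    (∃ x₁ ∈ X, ∃ x₂ ∈ X, inner ℝ (crossGrad g x y v) (x₁ - x) < 0 ∧
      0 < inner ℝ (crossGrad g x y v) (x₂ - x)) ∨
    (∃ c : ℝ, 0 < c ∧ ∀ x' ∈ X, c * ‖x' - x‖ ≤ |inner ℝ (crossGrad g x y v) (x' - x)|)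

/-- `Crit(x)`: the stationary points of `g(x, ·)` in `Y'`. -/
def crit (g : EuclideanSpace ℝ (Fin n) → EuclideanSpace ℝ (Fin m) → ℝ)
    (Y' : Set (EuclideanSpace ℝ (Fin m))) (x : EuclideanSpace ℝ (Fin n)) :
    Set (EuclideanSpace ℝ (Fin m)) :=
  {y ∈ Y' | gradY g x y = 0}

/-- `Crit_r(x)`: the points at distance at most `r` from `Crit(x)`. -/
def critNhd (g : EuclideanSpace ℝ (Fin n) → EuclideanSpace ℝ (Fin m) → ℝ)
    (Y' : Set (EuclideanSpace ℝ (Fin m))) (r : ENNReal) (x : EuclideanSpace ℝ (Fin n)) :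
    Set (EuclideanSpace ℝ (Fin m)) :=
  {y | Metric.infEDist y (crit g Y' x) ≤ r}

/-- `μ(δ)`: the largest lower bound for the absolute values of the eigenvalues of `∇²_yy g` at the
stationary points in `Y'`, over all `x ∈ X` outside the `δ`-neighbourhood of the bifurcation set
(`∞` if there are none). -/
def mu (g : EuclideanSpace ℝ (Fin n) → EuclideanSpace ℝ (Fin m) → ℝ)
    (X : Set (EuclideanSpace ℝ (Fin n))) (Y' : Set (EuclideanSpace ℝ (Fin m)))
    (δ : ℝ) : ENNReal :=
  ⨅ x ∈ X \ bifurcationNhd g X δ, ⨅ y ∈ crit g Y' x,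
    ⨅ (l : ℝ) (_ : Module.End.HasEigenvalue (hessYY g x y).toLinearMap l), ENNReal.ofReal |l|

/-- `α(δ, r)`: the largest lower bound for `‖∇_y g(x, y)‖` over all `x ∈ X` outside the
`δ`-neighbourhood of the bifurcation set and all `y ∈ Y` outside `Crit_r(x)` (`∞` if there are
none). -/
def alpha (g : EuclideanSpace ℝ (Fin n) → EuclideanSpace ℝ (Fin m) → ℝ)
    (X : Set (EuclideanSpace ℝ (Fin n))) (Y Y' : Set (EuclideanSpace ℝ (Fin m)))
    (δ : ℝ) (r : ENNReal) : ENNReal :=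
  ⨅ x ∈ X \ bifurcationNhd g X δ, ⨅ y ∈ Y \ critNhd g Y' r x, ENNReal.ofReal ‖gradY g x y‖

end

end FoldBifurcation

/-! Write `f = ∇_y g` and `H = ∂_y f`. Near a fold, the problem reduces to one scalar equation that
looks like `w·(x - x̄) + c t² = 0`, where `c ≠ 0` and `t` measures the degeneracy of `H`. The
bifurcation set is locally the zero set of the equation at `t = 0`, so at a stationary point the
distance to it is `O(t²)`, while every eigenvalue is at least a multiple of `|t|`. This is the
square root law.

The reduction comes from the bordered system `H z = d v`, `⟪v, z⟫ = 1` (`exists_bordered_solution`).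
Its solution `d` is `C¹`, vanishes at the fold and has nonzero derivative along `v` by the
third-derivative condition. Hence `(x, y, π) ↦ (x, f(x, y) - π v, d(x, y))` is a local
diffeomorphism. Its inverse over `(x, 0, t)` gives `y = sol(x, t)` and `π = eqn(x, t)` with `f(x,
sol) = eqn · v`. Symmetry of `H` yields `∂_t eqn = t · slope` with `slope ≠ 0`, so the quadratic
behaviour is available although `eqn` is only known to be `C¹` (`IsFoldAt.nonempty_reduction`).

Since `∂_x eqn = w` at the fold, non-tangency and convexity bound the distance within `X` to the
zeros of `eqn(·, 0)` by a multiple of `|eqn(x, 0)|`. This gives `dist(x, X̃) ≤ C (‖f‖ + d²)`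
(`FoldReduction.exists_degenerate_near`). With `f = 0` it is the eigenvalue bound. If instead `‖f‖ ≤
κ δ` and `dist > δ`, then `|d|` is at least of order `√δ`, and `eqn(x, ·)` has slope of order `√δ`
on a window of that width. It therefore vanishes there, which puts a stationary point within `A √δ`
(`FoldReduction.exists_zero_near`). Outside `Crit_r` with `r` of order `√δ` the residual must thus
exceed `κ δ`.

Nondegenerate zeros are handled by the inverse function theorem and nonzero values of `f` by
continuity. Compactness makes all constants uniform. -/

section FoldAnalysis

open Filter Topology

/-! ### Local inversion and stability of injectivity -/

section General

/-- The inverse function theorem for a `C¹` self-map of a finite-dimensional space. -/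
theorem exists_contDiffAt_local_inverse {V : Type*} [NormedAddCommGroup V] [NormedSpace ℝ V]
    [FiniteDimensional ℝ V] {G : V → V} {a : V} (hG : ContDiffAt ℝ 1 G a)
    (hinj : ∀ u, fderiv ℝ G a u = 0 → u = 0) :
    ∃ I : V → V, ContDiffAt ℝ 1 I (G a) ∧ I (G a) = a ∧ (∀ᶠ w in 𝓝 (G a), G (I w) = w) ∧
      (∀ᶠ u in 𝓝 a, I (G u) = u) ∧ ∀ w, fderiv ℝ G a (fderiv ℝ I (G a) w) = w := by
  have : CompleteSpace V := FiniteDimensional.complete ℝ V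
  let e : V ≃L[ℝ] V := (LinearEquiv.ofInjectiveEndo (fderiv ℝ G a).toLinearMap
    ((injective_iff_map_eq_zero _).2 hinj)).toContinuousLinearEquiv
  have he : (e : V →L[ℝ] V) = fderiv ℝ G a := by ext u; rfl
  have hs : HasStrictFDerivAt G (e : V →L[ℝ] V) a := by
    rw [he]; exact hG.hasStrictFDerivAt one_ne_zero
  refine ⟨hs.localInverse G e a, hG.to_localInverse hs.hasFDerivAt one_ne_zero,
    hs.localInverse_apply_image, hs.eventually_right_inverse, hs.eventually_left_inverse, ?_⟩
  intro w
  rw [hs.to_localInverse.hasFDerivAt.fderiv, ← he]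
  simp

/-- Injectivity of a linear map on a finite-dimensional space is stable, with a lower bound. -/
theorem eventually_norm_le_of_injective {P V W : Type*} [TopologicalSpace P]
    [NormedAddCommGroup V] [NormedSpace ℝ V] [FiniteDimensional ℝ V]
    [NormedAddCommGroup W] [NormedSpace ℝ W] {T : P → V →L[ℝ] W} {b : P}
    (hT : ContinuousAt T b) (hinj : ∀ u, T b u = 0 → u = 0) :
    ∃ c : ℝ, 0 < c ∧ ∀ᶠ p in 𝓝 b, ∀ u, c * ‖u‖ ≤ ‖T p u‖ := by
  obtain ⟨K, hK, hA⟩ := LinearMap.exists_antilipschitzWith (T b).toLinearMap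
    (LinearMap.ker_eq_bot'.2 hinj)
  have hK' : (0 : ℝ) < K := hK
  refine ⟨(K : ℝ)⁻¹ / 2, by positivity, ?_⟩
  have h1 : ∀ᶠ p in 𝓝 b, ‖T p - T b‖ < (K : ℝ)⁻¹ / 2 := by
    have : Tendsto (fun p => ‖T p - T b‖) (𝓝 b) (𝓝 0) := by
      have := (hT.sub (continuousAt_const (y := T b))).norm
      simpa [ContinuousAt] using this
    exact this.eventually (gt_mem_nhds (by positivity))
  filter_upwards [h1] with p hp u
  have h2 : ‖u‖ ≤ K * ‖T b u‖ := by
    have := hA.le_mul_dist u 0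
    simpa [dist_eq_norm] using this
  have h3 : (K : ℝ)⁻¹ * ‖u‖ ≤ ‖T b u‖ := by
    rw [inv_mul_le_iff₀ hK']; exact h2
  have h4 : ‖(T p - T b) u‖ ≤ (K : ℝ)⁻¹ / 2 * ‖u‖ :=
    (ContinuousLinearMap.le_opNorm _ _).trans (by gcongr)
  have h5 : ‖T b u‖ ≤ ‖T p u‖ + ‖(T p - T b) u‖ := by
    have : T b u = T p u - (T p - T b) u := by simp
    rw [this]; exact norm_sub_le _ _
  linarith

end General

/-! ### The bordered operator and the degeneracy function -/

section Bordered

variable {P F : Type*} [NormedAddCommGroup P] [NormedSpace ℝ P]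
  [NormedAddCommGroup F] [InnerProductSpace ℝ F]

/-- The bordered operator `(u, r) ↦ (T u - r v, ⟪v, u⟫)`. -/
noncomputable def bordered (v : F) (T : F →L[ℝ] F) : (F × ℝ) →L[ℝ] (F × ℝ) :=
  (ContinuousLinearMap.inl ℝ F ℝ).comp (T.comp (ContinuousLinearMap.fst ℝ F ℝ)) +
    ((-(ContinuousLinearMap.snd ℝ F ℝ).smulRight v).prod
      ((innerSL ℝ v).comp (ContinuousLinearMap.fst ℝ F ℝ)))

theorem bordered_apply (v : F) (T : F →L[ℝ] F) (u : F × ℝ) :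
    bordered v T u = (T u.1 - u.2 • v, inner ℝ v u.1) := by
  simp [bordered, sub_eq_add_neg]

theorem contDiffAt_bordered {n : WithTop ℕ∞} {H : P → F →L[ℝ] F} {b : P}
    (hH : ContDiffAt ℝ n H b) (v : F) : ContDiffAt ℝ n (fun p => bordered v (H p)) b := by
  unfold bordered
  exact (contDiffAt_const.clm_comp (hH.clm_comp contDiffAt_const)).add contDiffAt_const

/-- By symmetry the range of `T` is orthogonal to the kernel vector `v`, so `T u = r v` forces `r =
0`. Then `u` is a multiple of `v`, and the border `⟪v, u⟫ = 0` removes it. -/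
theorem bordered_injective {T : F →L[ℝ] F} {v : F} (hv : ‖v‖ = 1) (hTv : T v = 0)
    (hker : ∀ u, T u = 0 → ∃ t : ℝ, u = t • v)
    (hsymm : ∀ u u', inner ℝ (T u) u' = inner ℝ u (T u')) (u : F × ℝ)
    (hu : bordered v T u = 0) : u = 0 := by
  have hvv : inner ℝ v v = (1 : ℝ) := by simp [hv]
  rw [bordered_apply, Prod.mk_eq_zero] at hu
  have h1 : T u.1 = u.2 • v := sub_eq_zero.1 hu.1
  have h2 : u.2 = 0 := by
    have := hsymm u.1 v
    rw [hTv, h1, inner_smul_left, hvv] at this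
    simpa using this
  obtain ⟨t, ht⟩ := hker u.1 (by rw [h1, h2, zero_smul])
  have h3 := hu.2
  rw [ht, inner_smul_right, hvv, mul_one] at h3
  ext1
  · simp [ht, h3]
  · exact h2

variable [FiniteDimensional ℝ F]

/-- The solution `(z, d)` of the bordered system `H z = d v`, `⟪v, z⟫ = 1`: near a point where `H`
has the simple kernel `ℝ v`, the function `d` measures the degeneracy of `H`. -/
theorem exists_bordered_solution {H : P → F →L[ℝ] F} {b : P} (hH : ContDiffAt ℝ 1 H b) {v : F}
    (hv : ‖v‖ = 1) (hTv : H b v = 0) (hker : ∀ u, H b u = 0 → ∃ t : ℝ, u = t • v)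
    (hsymm : ∀ u u', inner ℝ (H b u) u' = inner ℝ u (H b u')) :
    ∃ (z : P → F) (d : P → ℝ), ContDiffAt ℝ 1 z b ∧ ContDiffAt ℝ 1 d b ∧ z b = v ∧ d b = 0 ∧
      (∀ᶠ p in 𝓝 b, H p (z p) = d p • v ∧ inner ℝ v (z p) = (1 : ℝ)) ∧
      ∀ ξ, fderiv ℝ d b ξ = inner ℝ v (fderiv ℝ H b ξ v) := by
  have hvv : inner ℝ v v = (1 : ℝ) := by simp [hv]
  let e : (F × ℝ) ≃L[ℝ] (F × ℝ) := (LinearEquiv.ofInjectiveEndo (bordered v (H b)).toLinearMap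
    ((injective_iff_map_eq_zero _).2
      (bordered_injective hv hTv hker hsymm))).toContinuousLinearEquiv
  have he : (e : (F × ℝ) →L[ℝ] (F × ℝ)) = bordered v (H b) := by ext u <;> rfl
  have hB := contDiffAt_bordered hH v
  have hinv : ContDiffAt ℝ 1 (fun p => (bordered v (H p)).inverse) b := by
    refine ContDiffAt.comp b (g := ContinuousLinearMap.inverse) ?_ hB
    rw [← he]
    exact contDiffAt_map_inverse e
  let s : P → F × ℝ := fun p => (bordered v (H p)).inverse (0, 1)
  have hs : ContDiffAt ℝ 1 s b := hinv.clm_apply contDiffAt_const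
  have hev : ∀ᶠ p in 𝓝 b, bordered v (H p) (s p) = (0, 1) := by
    have h0 := hB.continuousAt.tendsto
    rw [← he] at h0
    filter_upwards [h0.eventually (ContinuousLinearEquiv.nhds e)] with p hp
    obtain ⟨e', he'⟩ := hp
    have : (bordered v (H p)).IsInvertible := ⟨e', he'⟩
    exact this.self_apply_inverse _
  have hev' : ∀ᶠ p in 𝓝 b, H p (s p).1 = (s p).2 • v ∧ inner ℝ v (s p).1 = (1 : ℝ) := by
    filter_upwards [hev] with p hp
    rw [bordered_apply, Prod.mk.injEq] at hp
    exact ⟨sub_eq_zero.1 hp.1, hp.2⟩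
  have hsb : s b = (v, 0) := by
    have h1 : bordered v (H b) (s b - (v, 0)) = 0 := by
      rw [map_sub, hev.self_of_nhds, bordered_apply]
      simp [hTv, hv]
    exact sub_eq_zero.1 (bordered_injective hv hTv hker hsymm _ h1)
  refine ⟨fun p => (s p).1, fun p => (s p).2, hs.fst, hs.snd, congrArg Prod.fst hsb, congrArg Prod.snd hsb, hev', ?_⟩
  intro ξ
  have hz : HasFDerivAt (fun p => (s p).1) (fderiv ℝ (fun p => (s p).1) b) b :=
    (hs.fst.differentiableAt one_ne_zero).hasFDerivAt
  have hd : HasFDerivAt (fun p => (s p).2) (fderiv ℝ (fun p => (s p).2) b) b :=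
    (hs.snd.differentiableAt one_ne_zero).hasFDerivAt
  have hH' := (hH.differentiableAt one_ne_zero).hasFDerivAt
  have h1 := hH'.clm_apply hz
  have h2 := hd.smul_const v
  have h3 := (h1.congr_of_eventuallyEq (hev'.mono fun p hp => hp.1.symm)).unique h2
  -- Differentiating `H z = d v` and pairing with `v` eliminates the unknown derivative of `z`,
  -- because the range of `H b` is orthogonal to `v`.
  have h4 := congrArg (fun A => inner ℝ v (A ξ)) h3
  simp only [add_apply, ContinuousLinearMap.comp_apply,
    ContinuousLinearMap.flip_apply, ContinuousLinearMap.smulRight_apply, inner_add_right,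
    inner_smul_right, hvv, hsb] at h4
  rw [← hsymm, hTv, inner_zero_left, zero_add, mul_one] at h4
  exact h4.symm

/-- The degeneracy function is bounded by every eigenvalue. -/
theorem eventually_abs_le_mul_abs_eigenvalue {P : Type*} [TopologicalSpace P] {H : P → F →L[ℝ] F} {b : P} (hH : ContinuousAt H b)
    {v : F} (hv : ‖v‖ = 1) (hTv : H b v = 0) (hker : ∀ u, H b u = 0 → ∃ t : ℝ, u = t • v)
    (hsymm : ∀ᶠ p in 𝓝 b, ∀ u u', inner ℝ (H p u) u' = inner ℝ u (H p u'))
    {z : P → F} {d : P → ℝ} (hz : ContinuousAt z b) (hd : ContinuousAt d b) (hdb : d b = 0)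
    (hzd : ∀ᶠ p in 𝓝 b, H p (z p) = d p • v ∧ inner ℝ v (z p) = (1 : ℝ)) :
    ∃ C : ℝ, 0 < C ∧ ∀ᶠ p in 𝓝 b, ∀ (l : ℝ) (u : F), u ≠ 0 → H p u = l • u → |d p| ≤ C * |l| := by
  obtain ⟨c, hc, hcb⟩ := eventually_norm_le_of_injective
    (T := fun p => bordered v (H p)) (b := b) (by unfold bordered; fun_prop)
    (bordered_injective hv hTv hker hsymm.self_of_nhds)
  have hz1 : ∀ᶠ p in 𝓝 b, ‖z p‖ < ‖z b‖ + 1 := hz.norm.eventually (gt_mem_nhds (by linarith))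
  have hd1 : ∀ᶠ p in 𝓝 b, |d p| < 1 := by
    refine hd.abs.eventually (gt_mem_nhds ?_)
    simp [hdb]
  refine ⟨(‖z b‖ + 1) / c + 1 / c, by positivity, ?_⟩
  filter_upwards [hcb, hz1, hd1, hsymm, hzd] with p h1 h2 h3 h4 h5 l u hu hl
  have hu0 : 0 < ‖u‖ := norm_pos_iff.2 hu
  have h6 := h1 (u, 0)
  rw [bordered_apply] at h6
  simp only [hl, zero_smul, sub_zero, Prod.norm_def, norm_zero, norm_smul, Real.norm_eq_abs,
    max_eq_left hu0.le] at h6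
  -- Both sides are `⟪H u, z⟫ = ⟪u, H z⟫`. The lower bound on the bordered operator at `(u, 0)` then
  -- leaves two cases: `|l|` is bounded below, or `⟪v, u⟫` is comparable to `‖u‖` and this identity
  -- bounds `d` by `l`.
  have h7 : d p * inner ℝ v u = l * inner ℝ u (z p) := by
    have := h4 u (z p)
    rw [hl, h5.1, inner_smul_left, inner_smul_right, real_inner_comm] at this
    simp only [conj_trivial] at this
    rw [real_inner_comm, ← this, real_inner_comm]
  rw [add_mul]
  rcases le_max_iff.1 h6 with h | h
  · have : c ≤ |l| := le_of_mul_le_mul_right h hu0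
    have h8 : 1 ≤ 1 / c * |l| := by rw [one_div, le_inv_mul_iff₀ hc]; linarith
    have : 0 ≤ (‖z b‖ + 1) / c * |l| := by positivity
    linarith
  · have h9 : |d p| * (c * ‖u‖) ≤ |l| * (‖u‖ * (‖z b‖ + 1)) := by
      calc |d p| * (c * ‖u‖) ≤ |d p| * |inner ℝ v u| := by gcongr
        _ = |l| * |inner ℝ u (z p)| := by rw [← abs_mul, h7, abs_mul]
        _ ≤ |l| * (‖u‖ * ‖z p‖) := by gcongr; exact abs_real_inner_le_norm _ _
        _ ≤ _ := by gcongr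
    have h10 : |d p| * c ≤ |l| * (‖z b‖ + 1) := by
      refine le_of_mul_le_mul_right ?_ hu0
      linarith
    have h11 : |d p| ≤ (‖z b‖ + 1) / c * |l| := by
      rw [div_mul_eq_mul_div, le_div_iff₀ hc]; linarith
    have : 0 ≤ 1 / c * |l| := by positivity
    linarith

end Bordered

/-! ### Reduction of a fold to a scalar equation -/

section Fold

variable {E F : Type*} [NormedAddCommGroup E] [NormedSpace ℝ E]
  [NormedAddCommGroup F] [InnerProductSpace ℝ F]

/-- The partial derivative in the second variable. -/
noncomputable def partialSnd (f : E × F → F) (p : E × F) : F →L[ℝ] F :=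
  (fderiv ℝ f p).comp (ContinuousLinearMap.inr ℝ E F)

theorem partialSnd_apply (f : E × F → F) (p : E × F) (u : F) :
    partialSnd f p u = fderiv ℝ f p (0, u) := rfl

theorem ContDiffAt.partialSnd {f : E × F → F} {p : E × F} (hf : ContDiffAt ℝ 2 f p) :
    ContDiffAt ℝ 1 (partialSnd f) p :=
  (hf.fderiv_right (m := 1) (by norm_num [one_add_one_eq_two])).clm_comp contDiffAt_const

/-- `b` is a fold of the family `f` of gradient fields, with kernel direction `v`. -/
structure IsFoldAt (f : E × F → F) (b : E × F) (v : F) : Prop where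
  contDiffAt : ContDiffAt ℝ 2 f b
  zero : f b = 0
  norm_eq : ‖v‖ = 1
  ker_apply : partialSnd f b v = 0
  ker_le : ∀ u, partialSnd f b u = 0 → ∃ t : ℝ, u = t • v
  symm : ∀ᶠ p in 𝓝 b, ∀ u u', inner ℝ (partialSnd f p u) u' = inner ℝ u (partialSnd f p u')
  third : inner ℝ v (fderiv ℝ (partialSnd f) b (0, v) v) ≠ (0 : ℝ)

/-- A reduction of the equation `f (x, y) = 0` near a fold to a scalar equation `eqn (x, t) = 0`,
where `t = d (x, y)` measures the degeneracy of the partial derivative. -/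
structure FoldReduction (f : E × F → F) (b : E × F) (v : F) where
  d : E × F → ℝ
  sol : E × ℝ → F
  eqn : E × ℝ → ℝ
  slope : E × ℝ → ℝ
  C : ℝ
  C_pos : 0 < C
  continuousAt_d : ContinuousAt d b
  d_base : d b = 0
  continuousAt_sol : ContinuousAt sol (b.1, 0)
  sol_base : sol (b.1, 0) = b.2
  contDiffAt_eqn : ContDiffAt ℝ 1 eqn (b.1, 0)
  eqn_base : eqn (b.1, 0) = 0
  fderiv_eqn : ∀ ξ, fderiv ℝ eqn (b.1, 0) (ξ, 0) = inner ℝ v (fderiv ℝ f b (ξ, 0))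
  continuousAt_slope : ContinuousAt slope (b.1, 0)
  slope_base : slope (b.1, 0) ≠ 0
  hasDerivAt_eqn : ∀ᶠ q in 𝓝 (b.1, (0 : ℝ)),
    HasDerivAt (fun t => eqn (q.1, t)) (q.2 * slope q) q.2
  zero_of_eqn : ∀ᶠ q in 𝓝 (b.1, (0 : ℝ)), eqn q = 0 → f (q.1, sol q) = 0
  degenerate : ∀ᶠ q in 𝓝 (b.1, (0 : ℝ)), q.2 = 0 → ∃ u ≠ 0, partialSnd f (q.1, sol q) u = 0
  bound : ∀ᶠ p in 𝓝 b, |eqn (p.1, d p)| ≤ C * ‖f p‖ ∧ ‖p.2 - sol (p.1, d p)‖ ≤ C * ‖f p‖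
  d_le : ∀ᶠ p in 𝓝 b, ∀ (l : ℝ) (u : F), u ≠ 0 → partialSnd f p u = l • u → |d p| ≤ C * |l|
  lipschitz : ∃ s ∈ 𝓝 (b.1, (0 : ℝ)), ∀ q ∈ s, ∀ q' ∈ s, ‖sol q - sol q'‖ ≤ C * ‖q - q'‖

variable [FiniteDimensional ℝ E] [FiniteDimensional ℝ F]

/-- A Lyapunov–Schmidt reduction in which the kernel coordinate is replaced by the degeneracy `d`.
With this parameter the critical point of `eqn(x, ·)` lies at `t = 0` for every `x`. -/
theorem IsFoldAt.nonempty_reduction {f : E × F → F} {b : E × F} {v : F} (h : IsFoldAt f b v) :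
    Nonempty (FoldReduction f b v) := by
  have hvv : inner ℝ v v = (1 : ℝ) := by simp [h.norm_eq]
  have hsb := h.symm.self_of_nhds
  have hH := h.contDiffAt.partialSnd
  obtain ⟨z, d, hz, hd, hzb, hdb, hzd, hd'⟩ :=
    exists_bordered_solution hH h.norm_eq h.ker_apply h.ker_le hsb
  obtain ⟨C₁, hC₁, hdl⟩ := eventually_abs_le_mul_abs_eigenvalue hH.continuousAt h.norm_eq
    h.ker_apply h.ker_le h.symm hz.continuousAt hd.continuousAt hdb hzd
  have hf1 : ContDiffAt ℝ 1 f b := h.contDiffAt.of_le (by norm_num)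
  have hsplit : ∀ ξ η, fderiv ℝ f b (ξ, η) = fderiv ℝ f b (ξ, 0) + partialSnd f b η := by
    intro ξ η
    rw [partialSnd_apply, ← map_add]; simp
  let L : E × F × ℝ →L[ℝ] E × F := (ContinuousLinearMap.fst ℝ E (F × ℝ)).prod
    ((ContinuousLinearMap.fst ℝ F ℝ).comp (ContinuousLinearMap.snd ℝ E (F × ℝ)))
  let M : E × F × ℝ →L[ℝ] ℝ :=
    (ContinuousLinearMap.snd ℝ F ℝ).comp (ContinuousLinearMap.snd ℝ E (F × ℝ))
  let a : E × F × ℝ := (b.1, b.2, 0)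
  have hLa : L a = b := rfl
  -- The multiple `M u` of `v` supplies the direction missing from the range of `∂_y f`, and
  -- prescribing `d` fixes the position along the kernel.
  let G : E × F × ℝ → E × F × ℝ := fun u => (u.1, f (L u) - M u • v, d (L u))
  have hGa : G a = (b.1, 0, 0) := by
    simp [G, hLa, h.zero, hdb, a, M]
  have hfL : ContDiffAt ℝ 1 (fun u => f (L u)) a :=
    ContDiffAt.comp a (g := f) (by rwa [hLa]) L.contDiff.contDiffAt
  have hdL : ContDiffAt ℝ 1 (fun u => d (L u)) a :=
    ContDiffAt.comp a (g := d) (by rwa [hLa]) L.contDiff.contDiffAt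
  have hG : ContDiffAt ℝ 1 G a :=
    contDiff_fst.contDiffAt.prodMk
      ((hfL.sub (M.contDiff.contDiffAt.smul contDiffAt_const)).prodMk hdL)
  have hG' : ∀ u, fderiv ℝ G a u =
      (u.1, fderiv ℝ f b (L u) - M u • v, fderiv ℝ d b (L u)) := by
    have h1 : HasFDerivAt (fun u => f (L u)) ((fderiv ℝ f b).comp L) a :=
      HasFDerivAt.comp a (g := f)
        (by rw [hLa]; exact (hf1.differentiableAt one_ne_zero).hasFDerivAt) L.hasFDerivAt
    have h2 : HasFDerivAt (fun u => d (L u)) ((fderiv ℝ d b).comp L) a :=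
      HasFDerivAt.comp a (g := d)
        (by rw [hLa]; exact (hd.differentiableAt one_ne_zero).hasFDerivAt) L.hasFDerivAt
    have h3 : HasFDerivAt G _ a :=
      (ContinuousLinearMap.fst ℝ E (F × ℝ)).hasFDerivAt.prodMk
        ((h1.sub (M.hasFDerivAt.smul_const v)).prodMk h2)
    intro u
    rw [h3.fderiv]
    rfl
  have hinner : ∀ η, inner ℝ v (partialSnd f b η) = (0 : ℝ) := by
    intro η
    rw [← hsb, h.ker_apply, inner_zero_left]
  have hkernel : ∀ η (r : ℝ), partialSnd f b η = r • v → r = 0 ∧ ∃ t : ℝ, η = t • v := by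
    intro η r hr
    have : r = 0 := by
      have := hinner η
      rwa [hr, inner_smul_right, hvv, mul_one] at this
    exact ⟨this, h.ker_le η (by rw [hr, this, zero_smul])⟩
  have hd0 : ∀ t : ℝ, fderiv ℝ d b (0, t • v) = t * fderiv ℝ d b (0, v) := by
    intro t
    rw [← smul_eq_mul, ← map_smul]; simp
  obtain ⟨I, hI, hIa, hGI, hIG, hII⟩ := exists_contDiffAt_local_inverse hG (by
    rintro ⟨ξ, η, π⟩ hu
    rw [hG', Prod.mk_eq_zero, Prod.mk_eq_zero] at hu
    obtain ⟨h1, h2, h3⟩ := hu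
    simp only at h1
    subst h1
    obtain ⟨h4, t, rfl⟩ := hkernel η π (sub_eq_zero.1 h2)
    have h5 : t * fderiv ℝ d b (0, v) = 0 := by rw [← hd0]; exact h3
    rw [hd'] at h5
    -- The third-derivative condition says that `d` has nonzero derivative along the kernel
    -- direction `v`.
    have h6 := (mul_eq_zero.1 h5).resolve_right h.third
    simp [h4, h6])
  rw [hGa] at hI hIa hGI hII
  let J : E × ℝ →L[ℝ] E × F × ℝ := (ContinuousLinearMap.fst ℝ E ℝ).prod
    ((0 : E × ℝ →L[ℝ] F).prod (ContinuousLinearMap.snd ℝ E ℝ))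
  have hJ : J (b.1, 0) = (b.1, 0, 0) := rfl
  have hJt : Tendsto J (𝓝 (b.1, 0)) (𝓝 (b.1, 0, 0)) := hJ ▸ J.continuous.continuousAt
  have hIJ : ContDiffAt ℝ 1 (fun q => I (J q)) (b.1, 0) :=
    ContDiffAt.comp _ (g := I) (by rwa [hJ]) J.contDiff.contDiffAt
  have hIJb : I (J (b.1, 0)) = a := by rw [hJ, hIa]
  have hGJ : ∀ᶠ q in 𝓝 (b.1, (0 : ℝ)), G (I (J q)) = J q := hJt.eventually hGI
  -- the point over which `q` lies
  have hpt : Tendsto (fun q : E × ℝ => (q.1, (I (J q)).2.1)) (𝓝 (b.1, 0)) (𝓝 b) := by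
    have h1 : ContinuousAt (fun q : E × ℝ => (q.1, (I (J q)).2.1)) (b.1, 0) :=
      continuousAt_fst.prodMk hIJ.continuousAt.snd.fst
    have h2 := h1.tendsto
    rw [hIJb] at h2
    exact h2
  have hparts : ∀ q : E × ℝ, G (I (J q)) = J q → (I (J q)).1 = q.1 ∧
      f (q.1, (I (J q)).2.1) = (I (J q)).2.2 • v ∧ d (q.1, (I (J q)).2.1) = q.2 := by
    intro q hq
    have h1 : (I (J q)).1 = q.1 := congrArg Prod.fst hq
    have h2 : f (L (I (J q))) - M (I (J q)) • v = 0 := congrArg (fun w => w.2.1) hq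
    have h3 : d (L (I (J q))) = q.2 := congrArg (fun w => w.2.2) hq
    have h4 : L (I (J q)) = (q.1, (I (J q)).2.1) := by rw [← h1]; rfl
    rw [h4] at h2 h3
    exact ⟨h1, sub_eq_zero.1 h2, h3⟩
  obtain ⟨K, s, hs, hK⟩ := hI.exists_lipschitzOnWith
  -- The sum lets one positive constant serve for the eigenvalue bound `C₁` and the Lipschitz
  -- constant `K` of the inverse, which might be zero.
  have hKdist : ∀ w ∈ s, ∀ w' ∈ s, ‖I w - I w'‖ ≤ (C₁ + K) * ‖w - w'‖ := by
    intro w hw w' hw'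
    have := hK.dist_le_mul w hw w' hw'
    rw [dist_eq_norm, dist_eq_norm] at this
    refine this.trans ?_
    gcongr
    linarith
  refine ⟨{
    d := d
    sol := fun q => (I (J q)).2.1
    eqn := fun q => (I (J q)).2.2
    slope := fun q => inner ℝ v (fderiv ℝ I (J q) (0, 0, 1)).2.1
    C := C₁ + K
    C_pos := by positivity
    continuousAt_d := hd.continuousAt
    d_base := hdb
    continuousAt_sol := hIJ.continuousAt.snd.fst
    sol_base := by rw [hIJb]
    contDiffAt_eqn := hIJ.snd.snd
    eqn_base := by rw [hIJb]
    fderiv_eqn := ?_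
    continuousAt_slope := ?_
    slope_base := ?_
    hasDerivAt_eqn := ?_
    zero_of_eqn := ?_
    degenerate := ?_
    bound := ?_
    d_le := ?_
    lipschitz := ?_ }⟩
  · intro ξ
    have h1 : HasFDerivAt (fun q => (I (J q)).2.2)
        (M.comp ((fderiv ℝ I (b.1, 0, 0)).comp J)) (b.1, 0) := by
      refine M.hasFDerivAt.comp _ (HasFDerivAt.comp _ (g := I) ?_ J.hasFDerivAt)
      rw [hJ]
      exact (hI.differentiableAt one_ne_zero).hasFDerivAt
    rw [h1.fderiv]
    have h2 := hII (ξ, 0, 0)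
    rw [hG'] at h2
    set w := fderiv ℝ I (b.1, 0, 0) (ξ, 0, 0) with hw
    have h3 : w.1 = ξ := congrArg Prod.fst h2
    have h4 : fderiv ℝ f b (L w) - M w • v = 0 := congrArg (fun w => w.2.1) h2
    have h5 : L w = (ξ, w.2.1) := by rw [← h3]; rfl
    rw [h5, hsplit] at h4
    have h6 := congrArg (inner ℝ v) h4
    rw [inner_sub_right, inner_add_right, hinner, inner_smul_right, hvv, inner_zero_right] at h6
    change M w = _
    linarith
  · have h1 : ContinuousAt (fderiv ℝ I) (J (b.1, 0)) :=
      (hI.fderiv_right (m := 0) (by norm_num)).continuousAt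
    have h2 : ContinuousAt (fun q => fderiv ℝ I (J q)) (b.1, 0) :=
      ContinuousAt.comp (g := fderiv ℝ I) h1 J.continuous.continuousAt
    exact continuousAt_const.inner (h2.clm_apply continuousAt_const).snd.fst
  · intro h0
    have h2 := hII (0, 0, 1)
    rw [hG'] at h2
    rw [hJ] at h0
    set w := fderiv ℝ I (b.1, 0, 0) (0, 0, 1) with hw
    have h3 : w.1 = 0 := congrArg Prod.fst h2
    have h4 : fderiv ℝ f b (L w) - M w • v = 0 := congrArg (fun w => w.2.1) h2
    have h5 : L w = (0, w.2.1) := by rw [← h3]; rfl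
    have h6 : fderiv ℝ d b (L w) = 1 := congrArg (fun w => w.2.2) h2
    rw [h5] at h4 h6
    obtain ⟨-, t, ht⟩ := hkernel w.2.1 (M w) (sub_eq_zero.1 h4)
    rw [ht, inner_smul_right, hvv, mul_one] at h0
    rw [ht, h0] at h6
    simp [Prod.mk_zero_zero] at h6
  · have hId : ∀ᶠ q in 𝓝 (b.1, (0 : ℝ)), DifferentiableAt ℝ I (J q) :=
      hJt.eventually ((hI.eventually (by simp)).mono fun w hw => hw.differentiableAt one_ne_zero)
    have hfd : ∀ᶠ p in 𝓝 b, DifferentiableAt ℝ f p :=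
      (hf1.eventually (by simp)).mono fun w hw => hw.differentiableAt one_ne_zero
    filter_upwards [hGJ.eventually_nhds, hId, hpt.eventually hfd, hpt.eventually hzd,
      hpt.eventually h.symm] with q h1 h2 h3 h4 h5
    have hcurve : HasDerivAt (fun t : ℝ => J (q.1, t)) (0, 0, 1) q.2 :=
      (hasDerivAt_const q.2 q.1).prodMk ((hasDerivAt_const q.2 (0 : F)).prodMk (hasDerivAt_id q.2))
    have h6 : HasDerivAt (fun t : ℝ => I (J (q.1, t))) (fderiv ℝ I (J q) (0, 0, 1)) q.2 :=
      h2.hasFDerivAt.comp_hasDerivAt q.2 hcurve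
    set w := fderiv ℝ I (J q) (0, 0, 1) with hw
    have h7 : HasDerivAt (fun t : ℝ => (I (J (q.1, t))).2.1) w.2.1 q.2 := h6.snd.fst
    have h8 : HasDerivAt (fun t : ℝ => (I (J (q.1, t))).2.2) w.2.2 q.2 := h6.snd.snd
    have h9 : HasDerivAt (fun t : ℝ => f (q.1, (I (J (q.1, t))).2.1))
        (partialSnd f (q.1, (I (J q)).2.1) w.2.1) q.2 :=
      h3.hasFDerivAt.comp_hasDerivAt q.2 ((hasDerivAt_const q.2 q.1).prodMk h7)
    have h10 : (fun t : ℝ => f (q.1, (I (J (q.1, t))).2.1)) =ᶠ[𝓝 q.2]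
        fun t => (I (J (q.1, t))).2.2 • v := by
      have : Tendsto (fun t : ℝ => (q.1, t)) (𝓝 q.2) (𝓝 q) :=
        (continuous_const.prodMk continuous_id).continuousAt
      filter_upwards [this.eventually h1] with t ht
      exact (hparts _ ht).2.1
    have h11 := (h9.congr_of_eventuallyEq h10.symm).unique (h8.smul_const v)
    -- Differentiating `f(x, sol) = eqn · v` in `t` gives `H (∂_t sol) = (∂_t eqn) v`. Pairing with
    -- `z` and moving `H` across turns this into `∂_t eqn = t ⟪v, ∂_t sol⟫`.
    have h12 : w.2.2 = q.2 * inner ℝ v w.2.1 := by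
      have h13 := h5 w.2.1 (z (q.1, (I (J q)).2.1))
      rw [h11, h4.1, (hparts q h1.self_of_nhds).2.2, inner_smul_left, inner_smul_right, h4.2,
        real_inner_comm] at h13
      simpa using h13
    rw [← h12]
    exact h8
  · filter_upwards [hGJ] with q hq h0
    rw [(hparts q hq).2.1, h0, zero_smul]
  · filter_upwards [hGJ, hpt.eventually hzd] with q hq h1 h0
    refine ⟨z (q.1, (I (J q)).2.1), ?_, ?_⟩
    · intro h2
      have := h1.2
      rw [h2, inner_zero_right] at this
      exact zero_ne_one this
    · rw [h1.1, (hparts q hq).2.2, h0, zero_smul]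
  · have t1 : Tendsto (fun p : E × F => ((p.1, p.2, 0) : E × F × ℝ)) (𝓝 b) (𝓝 a) :=
      (continuous_fst.prodMk (continuous_snd.prodMk continuous_const)).continuousAt
    have t2 : Tendsto (fun p : E × F => G (p.1, p.2, 0)) (𝓝 b) (𝓝 (b.1, 0, 0)) := by
      rw [← hGa]; exact hG.continuousAt.tendsto.comp t1
    have t3 : Tendsto (fun p : E × F => J (p.1, d p)) (𝓝 b) (𝓝 (b.1, 0, 0)) := by
      refine hJt.comp ?_
      rw [← hdb]
      exact continuousAt_fst.prodMk hd.continuousAt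
    filter_upwards [t1.eventually hIG, t2.eventually hs, t3.eventually hs] with p h1 h2 h3
    have h4 := hKdist _ h3 _ h2
    rw [h1] at h4
    -- The two points share the coordinates `x` and `d p` and differ only by `f p`. Their images
    -- under `I` are `(x, sol, eqn)` and `(x, y, 0)`, so the Lipschitz bound gives both estimates.
    have h5 : ‖J (p.1, d p) - G (p.1, p.2, 0)‖ = ‖f p‖ := by
      have h6 : J (p.1, d p) - G (p.1, p.2, 0) = (0, - f p, 0) := by
        simp [J, G, L, M]
      rw [h6]
      simp [Prod.norm_def]
    rw [h5] at h4
    constructor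
    · refine le_trans ?_ h4
      refine le_trans (le_of_eq ?_) ((norm_snd_le _).trans (norm_snd_le _))
      simp
    · refine le_trans ?_ h4
      refine le_trans (le_of_eq ?_) ((norm_fst_le _).trans (norm_snd_le _))
      rw [norm_sub_rev]
      simp
  · filter_upwards [hdl] with p hp l u hu hl
    refine (hp l u hu hl).trans ?_
    gcongr
    linarith [K.2]
  · refine ⟨_, hJt.eventually hs, ?_⟩
    intro q hq q' hq'
    have h1 := hKdist _ hq _ hq'
    have h2 : ‖J q - J q'‖ = ‖q - q'‖ := by
      rw [← map_sub]
      simp [J, Prod.norm_def]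
    rw [h2] at h1
    exact ((norm_fst_le _).trans (norm_snd_le _)).trans h1

end Fold

/-! ### Distance to a zero set that is not tangent to a convex set -/

section Transversal

variable {E : Type*} [NormedAddCommGroup E] [InnerProductSpace ℝ E]

/-- A function with derivative `w` at `x₀`, nonnegative at a point `x` of the convex set `X` close
to `x₀`, vanishes at a point of `X` close to `x` if `X` has a point on the negative side of the
hyperplane with normal `w`. -/
theorem exists_zero_of_inner_neg {X : Set E} (hX : Convex ℝ X) {x₀ x₁ w : E} {a : E → ℝ}
    (ha : HasStrictFDerivAt a (innerSL ℝ w) x₀) (hac : ∀ᶠ x in 𝓝 x₀, ContinuousAt a x)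
    (ha0 : a x₀ = 0) (hx₁ : x₁ ∈ X) (hw : inner ℝ w (x₁ - x₀) < (0 : ℝ)) {N : Set E}
    (hN : N ∈ 𝓝 x₀) :
    ∃ C : ℝ, 0 < C ∧ ∀ᶠ x in 𝓝 x₀, x ∈ X → 0 ≤ a x →
      ∃ x' ∈ X, x' ∈ N ∧ a x' = 0 ∧ ‖x - x'‖ ≤ C * |a x| := by
  set c : ℝ := -inner ℝ w (x₁ - x₀) with hc
  have hc0 : 0 < c := by linarith
  set R : ℝ := ‖x₁ - x₀‖ + 1 with hR
  have hR0 : 0 < R := by positivity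
  -- Strict differentiability is needed because the linear approximation is used between two points,
  -- neither of which is `x₀`.
  have hstrict := ha.isLittleO.bound (show 0 < c / (4 * R) by positivity)
  rw [nhds_prod_eq] at hstrict
  obtain ⟨U, hU, hUs⟩ := (eventually_prod_self_iff (r := fun u u' =>
    ‖a u - a u' - innerSL ℝ w (u - u')‖ ≤ c / (4 * R) * ‖u - u'‖)).1 hstrict
  obtain ⟨ρ, hρ, hball⟩ := Metric.mem_nhds_iff.1 (inter_mem (inter_mem hU hN) hac)
  refine ⟨4 * R / c, by positivity, ?_⟩
  have e1 : ∀ᶠ x in 𝓝 x₀, x ∈ Metric.ball x₀ (ρ / 2) := Metric.ball_mem_nhds _ (by positivity)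
  have e2 : ∀ᶠ x in 𝓝 x₀, inner ℝ w (x₁ - x) < (-c / 2 : ℝ) := by
    have : ContinuousAt (fun x => (inner ℝ w (x₁ - x) : ℝ)) x₀ := by fun_prop
    exact this.eventually (gt_mem_nhds (by linarith))
  have e3 : ∀ᶠ x in 𝓝 x₀, ‖x₁ - x‖ < R := by
    have : ContinuousAt (fun x => ‖x₁ - x‖) x₀ := by fun_prop
    exact this.eventually (gt_mem_nhds (by linarith))
  have e4 : ∀ᶠ x in 𝓝 x₀, 4 / c * a x < min 1 (ρ / (2 * R)) := by
    have : ContinuousAt (fun x => 4 / c * a x) x₀ := continuousAt_const.mul hac.self_of_nhds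
    exact this.eventually (gt_mem_nhds (by
      change 4 / c * a x₀ < _
      rw [ha0, mul_zero]; positivity))
  filter_upwards [e1, e2, e3, e4] with x h1 h2 h3 h4 hxX hax
  -- Towards `x₁` the linear part falls at rate at least `c / 2` and the error costs at most `c /
  -- 4`. A step of `4 a(x) / c` therefore brings `a` to zero or below.
  set t : ℝ := 4 / c * a x with ht
  have ht0 : 0 ≤ t := by positivity
  have ht1 : t ≤ 1 := (h4.trans_le (min_le_left _ _)).le
  have htR : t * R < ρ / 2 := by
    have := h4.trans_le (min_le_right _ _)
    rw [lt_div_iff₀ (by positivity)] at this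
    linarith
  have hmem : ∀ s ∈ Set.Icc 0 t, x + s • (x₁ - x) ∈ Metric.ball x₀ ρ := by
    intro s hs
    have h5 : ‖s • (x₁ - x)‖ ≤ t * R := by
      rw [norm_smul, Real.norm_of_nonneg hs.1]
      exact mul_le_mul hs.2 h3.le (norm_nonneg _) ht0
    rw [mem_ball_iff_norm] at h1 ⊢
    calc ‖x + s • (x₁ - x) - x₀‖ = ‖(x - x₀) + s • (x₁ - x)‖ := by congr 1; abel
      _ ≤ ‖x - x₀‖ + ‖s • (x₁ - x)‖ := norm_add_le _ _
      _ < ρ := by linarith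
  have hcont : ContinuousOn (fun s : ℝ => a (x + s • (x₁ - x))) (Set.Icc 0 t) := by
    intro s hs
    have h5 : ContinuousAt a (x + s • (x₁ - x)) := (hball (hmem s hs)).2
    exact (ContinuousAt.comp (f := fun s : ℝ => x + s • (x₁ - x)) h5
      (by fun_prop)).continuousWithinAt
  have hend : a (x + t • (x₁ - x)) ≤ 0 := by
    have hm0 := hmem 0 ⟨le_rfl, ht0⟩
    rw [zero_smul, add_zero] at hm0
    have h5 := hUs _ (hball (hmem t ⟨ht0, le_rfl⟩)).1.1 _ (hball hm0).1.1
    simp only [add_sub_cancel_left, innerSL_apply_apply, inner_smul_right, norm_smul,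
      Real.norm_eq_abs, abs_of_nonneg ht0] at h5
    have h6 := (abs_le.1 h5).2
    have h7 : c / (4 * R) * (t * ‖x₁ - x‖) ≤ c / 4 * t := by
      calc c / (4 * R) * (t * ‖x₁ - x‖) ≤ c / (4 * R) * (t * R) := by gcongr
        _ = c / 4 * t := by field_simp
    have h8 : t * inner ℝ w (x₁ - x) ≤ t * (-c / 2) := mul_le_mul_of_nonneg_left h2.le ht0
    have h9 : c / 4 * t = a x := by rw [ht]; field_simp
    linarith
  obtain ⟨s, hs, hs0⟩ := intermediate_value_Icc' ht0 hcont
    (show (0 : ℝ) ∈ Set.Icc _ _ from ⟨hend, by simpa using hax⟩)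
  refine ⟨x + s • (x₁ - x), ?_, (hball (hmem s hs)).1.2, hs0, ?_⟩
  · exact hX.add_smul_sub_mem hxX hx₁ ⟨hs.1, hs.2.trans ht1⟩
  · rw [sub_add_cancel_left, norm_neg, norm_smul, Real.norm_of_nonneg hs.1, abs_of_nonneg hax]
    calc s * ‖x₁ - x‖ ≤ t * R := mul_le_mul hs.2 h3.le (norm_nonneg _) ht0
      _ = 4 * R / c * a x := by rw [ht]; ring

/-- A function vanishing at `x₀` whose zero set is not tangent to the convex set `X` at `x₀` bounds
the distance within `X` to its zero set. -/
theorem exists_zero_of_not_tangent {X : Set E} (hX : Convex ℝ X) {x₀ w : E} (hx₀ : x₀ ∈ X)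
    {a : E → ℝ} (ha : HasStrictFDerivAt a (innerSL ℝ w) x₀)
    (hac : ∀ᶠ x in 𝓝 x₀, ContinuousAt a x) (ha0 : a x₀ = 0)
    (hT : (∃ x₁ ∈ X, ∃ x₂ ∈ X, inner ℝ w (x₁ - x₀) < (0 : ℝ) ∧ (0 : ℝ) < inner ℝ w (x₂ - x₀)) ∨
      ∃ c : ℝ, 0 < c ∧ ∀ x' ∈ X, c * ‖x' - x₀‖ ≤ |inner ℝ w (x' - x₀)|)
    {N : Set E} (hN : N ∈ 𝓝 x₀) :
    ∃ C : ℝ, 0 < C ∧ ∀ᶠ x in 𝓝 x₀, x ∈ X →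
      ∃ x' ∈ X, x' ∈ N ∧ a x' = 0 ∧ ‖x - x'‖ ≤ C * |a x| := by
  rcases hT with ⟨x₁, hx₁, x₂, hx₂, hw₁, hw₂⟩ | ⟨c, hc, hcX⟩
  · obtain ⟨C₁, hC₁, h₁⟩ := exists_zero_of_inner_neg hX ha hac ha0 hx₁ hw₁ hN
    obtain ⟨C₂, hC₂, h₂⟩ := exists_zero_of_inner_neg hX (a := fun x => -a x) (w := -w)
      (by rw [map_neg]; exact ha.neg) (hac.mono fun x hx => hx.neg) (by simp [ha0]) hx₂
      (by rw [inner_neg_left]; linarith) hN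
    refine ⟨C₁ + C₂, by positivity, ?_⟩
    filter_upwards [h₁, h₂] with x h1 h2 hxX
    have := abs_nonneg (a x)
    rcases le_total 0 (a x) with h | h
    · obtain ⟨x', hx', hxN, h0, hle⟩ := h1 hxX h
      exact ⟨x', hx', hxN, h0, hle.trans (by nlinarith)⟩
    · obtain ⟨x', hx', hxN, h0, hle⟩ := h2 hxX (by linarith)
      rw [abs_neg] at hle
      exact ⟨x', hx', hxN, by linarith, hle.trans (by nlinarith)⟩
  · refine ⟨2 / c, by positivity, ?_⟩
    have h1 := ha.hasFDerivAt.isLittleO.bound (show 0 < c / 2 by positivity)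
    filter_upwards [h1] with x hx hxX
    -- In the second alternative `|a x|` is at least `c / 2` times the distance to `x₀`, so `x₀`
    -- itself serves as the zero.
    refine ⟨x₀, hx₀, mem_of_mem_nhds hN, ha0, ?_⟩
    rw [ha0, sub_zero, innerSL_apply_apply, Real.norm_eq_abs] at hx
    have h2 := hcX x hxX
    have h3 := abs_sub_abs_le_abs_sub (inner ℝ w (x - x₀) : ℝ) (a x)
    rw [abs_sub_comm] at h3
    rw [div_mul_eq_mul_div, le_div_iff₀ hc]
    linarith

end Transversal

/-- With slope at least `k` in absolute value and of fixed sign, `φ` moves by at least `k τ` on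
either side of `d`, enough to cross zero. -/
theorem exists_zero_of_deriv_bound {φ φ' : ℝ → ℝ} {d τ k : ℝ} (hτ : 0 ≤ τ)
    (hφ : ∀ s ∈ Set.Icc (d - τ) (d + τ), HasDerivAt φ (φ' s) s)
    (hk : (∀ s ∈ Set.Icc (d - τ) (d + τ), k ≤ φ' s) ∨
      ∀ s ∈ Set.Icc (d - τ) (d + τ), φ' s ≤ -k)
    (h0 : |φ d| ≤ k * τ) : ∃ s ∈ Set.Icc (d - τ) (d + τ), φ s = 0 := by
  wlog hk' : ∀ s ∈ Set.Icc (d - τ) (d + τ), k ≤ φ' s generalizing φ φ'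
  · obtain ⟨s, hs, h⟩ := this (φ := fun s => -φ s) (φ' := fun s => -φ' s)
      (fun s hs => (hφ s hs).neg)
      (Or.inl fun s hs => by have := hk.resolve_left hk' s hs; linarith) (by rwa [abs_neg])
      (fun s hs => by have := hk.resolve_left hk' s hs; linarith)
    exact ⟨s, hs, by linarith⟩
  have hc : ContinuousOn φ (Set.Icc (d - τ) (d + τ)) := fun s hs =>
    (hφ s hs).continuousAt.continuousWithinAt
  have hmv := (convex_Icc (d - τ) (d + τ)).mul_sub_le_image_sub_of_le_deriv hc
    (fun s hs => (hφ s (interior_subset hs)).differentiableAt.differentiableWithinAt) (C := k)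
    (fun s hs => by rw [(hφ s (interior_subset hs)).deriv]; exact hk' s (interior_subset hs))
  have h1 := hmv (d - τ) ⟨le_rfl, by linarith⟩ d ⟨by linarith, by linarith⟩ (by linarith)
  have h2 := hmv d ⟨by linarith, by linarith⟩ (d + τ) ⟨by linarith, le_rfl⟩ (by linarith)
  have h3 := abs_le.1 h0
  exact intermediate_value_Icc (by linarith) hc
    (show (0 : ℝ) ∈ Set.Icc _ _ from ⟨by linarith, by linarith⟩)

/-- Here `θ √δ` is the half-width of the window searched for a zero and `κ δ` the admissible
residual. The bound on `θ²` keeps the window away from `t = 0`, and `C κ ≤ 1/2` absorbs the residual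
in the distance estimate. The bound by `k θ²` makes the residual small enough for a zero in the
window, and the two bounds by `A / 2` share out the final error. -/
theorem exists_fold_constants {C K k A : ℝ} (hC : 0 < C) (hK : 0 < K) (hk : 0 < k) (hA : 0 < A) :
    ∃ θ κ : ℝ, 0 < θ ∧ 0 < κ ∧ K * θ ≤ A / 2 ∧ θ ^ 2 ≤ 1 / (8 * C) ∧ C * κ ≤ 1 / 2 ∧
      K * κ ≤ k * θ ^ 2 ∧ K * κ ≤ A / 2 := by
  set θ : ℝ := min (A / (2 * K)) (min 1 (1 / (8 * C))) with hθ
  have hθ0 : 0 < θ := by positivity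
  have hθA : K * θ ≤ A / 2 := by
    calc K * θ ≤ K * (A / (2 * K)) := by gcongr; exact min_le_left _ _
      _ = A / 2 := by field_simp
  have hθC : θ ^ 2 ≤ 1 / (8 * C) := by
    have h1 : θ ≤ 1 := (min_le_right _ _).trans (min_le_left _ _)
    have h2 : θ ≤ 1 / (8 * C) := (min_le_right _ _).trans (min_le_right _ _)
    nlinarith
  set κ : ℝ := min (1 / (2 * C)) (min (k * θ ^ 2 / K) (A / (2 * K))) with hκ
  have hκ0 : 0 < κ := by positivity
  have hκC : C * κ ≤ 1 / 2 := by
    calc C * κ ≤ C * (1 / (2 * C)) := by gcongr; exact min_le_left _ _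
      _ = 1 / 2 := by field_simp
  have hκk : K * κ ≤ k * θ ^ 2 := by
    calc K * κ ≤ K * (k * θ ^ 2 / K) := by
          gcongr; exact (min_le_right _ _).trans (min_le_left _ _)
      _ = k * θ ^ 2 := by field_simp
  have hκA : K * κ ≤ A / 2 := by
    calc K * κ ≤ K * (A / (2 * K)) := by
          gcongr; exact (min_le_right _ _).trans (min_le_right _ _)
      _ = A / 2 := by field_simp
  exact ⟨θ, κ, hθ0, hκ0, hθA, hθC, hκC, hκk, hκA⟩

/-! ### Quantitative estimates near a fold -/

section Estimates

variable {E F : Type*} [NormedAddCommGroup E] [InnerProductSpace ℝ E]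
  [NormedAddCommGroup F] [InnerProductSpace ℝ F]

/-- The base points over which the family `f` has a degenerate zero. -/
def degenerateSet (f : E × F → F) (X : Set E) : Set E :=
  {x ∈ X | ∃ y, f (x, y) = 0 ∧ ∃ u ≠ 0, partialSnd f (x, y) u = 0}

/-- Near a fold, the distance to the degenerate set is at most linear in the residual and quadratic
in the degeneracy. -/
theorem FoldReduction.exists_degenerate_near {f : E × F → F} {b : E × F} {v : F}
    (R : FoldReduction f b v) {X : Set E} (hX : Convex ℝ X) (hb : b.1 ∈ X) {w : E}
    (hw : ∀ ξ, inner ℝ w ξ = inner ℝ v (fderiv ℝ f b (ξ, 0)))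
    (hT : (∃ x₁ ∈ X, ∃ x₂ ∈ X, inner ℝ w (x₁ - b.1) < (0 : ℝ) ∧
        (0 : ℝ) < inner ℝ w (x₂ - b.1)) ∨
      ∃ c : ℝ, 0 < c ∧ ∀ x' ∈ X, c * ‖x' - b.1‖ ≤ |inner ℝ w (x' - b.1)|) :
    ∃ C : ℝ, 0 < C ∧ ∀ᶠ p in 𝓝 b, p.1 ∈ X →
      ∃ x' ∈ degenerateSet f X, ‖p.1 - x'‖ ≤ C * (‖f p‖ + R.d p ^ 2) := by
  have hι : Tendsto (fun x : E => (x, (0 : ℝ))) (𝓝 b.1) (𝓝 (b.1, 0)) :=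
    (continuous_id.prodMk continuous_const).continuousAt
  have hstrict : HasStrictFDerivAt (fun x : E => R.eqn (x, 0)) (innerSL ℝ w) b.1 := by
    have h1 := R.contDiffAt_eqn.hasStrictFDerivAt one_ne_zero
    have h2 : HasStrictFDerivAt (fun x : E => R.eqn (x, 0))
        ((fderiv ℝ R.eqn (b.1, 0)).comp (ContinuousLinearMap.inl ℝ E ℝ)) b.1 :=
      HasStrictFDerivAt.comp b.1 (g := R.eqn) h1 
        (ContinuousLinearMap.inl ℝ E ℝ).hasStrictFDerivAt
    convert h2 using 1
    ext ξ
    simp [hw, R.fderiv_eqn]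
  have hcont : ∀ᶠ x in 𝓝 b.1, ContinuousAt (fun x : E => R.eqn (x, 0)) x := by
    filter_upwards [hι.eventually (R.contDiffAt_eqn.eventually (by simp))] with x hx
    exact ContinuousAt.comp (f := fun x : E => (x, (0 : ℝ))) hx.continuousAt (by fun_prop)
  have hN : ∀ᶠ x in 𝓝 b.1, (R.eqn (x, 0) = 0 → f (x, R.sol (x, 0)) = 0) ∧
      ∃ u ≠ 0, partialSnd f (x, R.sol (x, 0)) u = 0 := by
    filter_upwards [hι.eventually R.zero_of_eqn, hι.eventually R.degenerate] with x h1 h2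
    exact ⟨h1, h2 rfl⟩
  obtain ⟨C₁, hC₁, h₁⟩ := exists_zero_of_not_tangent hX hb hstrict hcont R.eqn_base hT hN
  have hslope : ∀ᶠ q in 𝓝 (b.1, (0 : ℝ)), |R.slope q| < |R.slope (b.1, 0)| + 1 :=
    R.continuousAt_slope.abs.eventually (gt_mem_nhds (by linarith))
  obtain ⟨ρ, hρ, hbox⟩ := Metric.eventually_nhds_iff.1 (hslope.and R.hasDerivAt_eqn)
  set k := |R.slope (b.1, 0)| + 1 with hk
  have hk0 : 0 < k := by positivity
  refine ⟨C₁ * (R.C + k), mul_pos hC₁ (add_pos R.C_pos hk0), ?_⟩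
  have e1 : ∀ᶠ p in 𝓝 b, dist p.1 b.1 < ρ :=
    (continuous_fst.tendsto b).eventually (Metric.ball_mem_nhds _ hρ)
  have e2 : ∀ᶠ p in 𝓝 b, |R.d p| < ρ :=
    R.continuousAt_d.abs.eventually (gt_mem_nhds (by simpa [R.d_base]))
  filter_upwards [(continuous_fst.tendsto b).eventually h₁, e1, e2, R.bound] with p h1 h2 h3 h4 hpX
  obtain ⟨x', hx'X, hx'N, hx'0, hx'⟩ := h1 hpX
  refine ⟨x', ⟨hx'X, _, hx'N.1 hx'0, hx'N.2⟩, hx'.trans ?_⟩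
  rw [mul_assoc]
  gcongr
  set t := R.d p
  -- The derivative `s · slope` is at most `|t| k` between `0` and `t`, so passing from `d p` to
  -- degeneracy `0` changes `eqn` only by `k t²`.
  have hmv : ‖R.eqn (p.1, 0) - R.eqn (p.1, t)‖ ≤ (|t| * k) * ‖(0 : ℝ) - t‖ := by
    have hin : ∀ s ∈ Set.uIcc 0 t, |s| ≤ |t| := fun s hs => by
      simpa using Set.abs_sub_left_of_mem_uIcc hs
    have hb' : ∀ s ∈ Set.uIcc 0 t, |R.slope (p.1, s)| < k ∧
        HasDerivAt (fun t => R.eqn (p.1, t)) (s * R.slope (p.1, s)) s := fun s hs =>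
      hbox (y := (p.1, s)) (by
        rw [Prod.dist_eq, max_lt_iff, Real.dist_eq, sub_zero]
        exact ⟨h2, (hin s hs).trans_lt h3⟩)
    refine (convex_uIcc 0 t).norm_image_sub_le_of_norm_hasDerivWithin_le
      (f := fun s => R.eqn (p.1, s)) (fun s hs => (hb' s hs).2.hasDerivWithinAt)
      (fun s hs => ?_) Set.right_mem_uIcc Set.left_mem_uIcc
    rw [norm_mul]
    exact mul_le_mul (hin s hs) (hb' s hs).1.le (norm_nonneg _) (abs_nonneg _)
  simp only [zero_sub, norm_neg, Real.norm_eq_abs] at hmv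
  have h5 := abs_sub_abs_le_abs_sub (R.eqn (p.1, 0)) (R.eqn (p.1, t))
  have h6 : |t| * k * |t| = k * t ^ 2 := by rw [← sq_abs t]; ring
  have h7 := mul_nonneg R.C_pos.le (sq_nonneg t)
  have h8 := mul_nonneg hk0.le (norm_nonneg (f p))
  nlinarith [h4.1]

/-- Near a fold, a point with residual at most `κ δ` over a base point at distance more than `δ`
from the degenerate set has a zero within `A √δ`. -/
theorem FoldReduction.exists_zero_near {f : E × F → F} {b : E × F} {v : F}
    (R : FoldReduction f b v) (hfb : f b = 0) {X : Set E} (hb : b.1 ∈ X) {C : ℝ} (hC : 0 < C)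
    (hS : ∀ᶠ p in 𝓝 b, p.1 ∈ X →
      ∃ x' ∈ degenerateSet f X, ‖p.1 - x'‖ ≤ C * (‖f p‖ + R.d p ^ 2))
    {A : ℝ} (hA : 0 < A) {N : Set F} (hN : N ∈ 𝓝 b.2) :
    ∃ κ : ℝ, 0 < κ ∧ ∀ᶠ p in 𝓝 b, p.1 ∈ X → ∀ δ : ℝ, 0 < δ →
      (∀ x' ∈ degenerateSet f X, δ < ‖p.1 - x'‖) → ‖f p‖ ≤ κ * δ →
      δ ≤ 1 ∧ ∃ y ∈ N, f (p.1, y) = 0 ∧ ‖p.2 - y‖ ≤ A * √δ := by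
  have hbS : b.1 ∈ degenerateSet f X := by
    refine ⟨hb, b.2, hfb, ?_⟩
    have := R.degenerate.self_of_nhds rfl
    rwa [R.sol_base] at this
  have hRC := R.C_pos
  have hsol : ∀ᶠ q in 𝓝 (b.1, (0 : ℝ)), R.sol q ∈ N := by
    have := R.continuousAt_sol.tendsto
    rw [R.sol_base] at this
    exact this hN
  obtain ⟨k, hk, hslope⟩ : ∃ k : ℝ, 0 < k ∧ ((∀ᶠ q in 𝓝 (b.1, (0 : ℝ)), k < R.slope q) ∨
      ∀ᶠ q in 𝓝 (b.1, (0 : ℝ)), R.slope q < -k) := by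
    rcases R.slope_base.lt_or_gt with h | h
    · exact ⟨-R.slope (b.1, 0) / 2, by linarith,
        Or.inr (R.continuousAt_slope.eventually (gt_mem_nhds (by linarith)))⟩
    · exact ⟨R.slope (b.1, 0) / 2, by linarith,
        Or.inl (R.continuousAt_slope.eventually (lt_mem_nhds (by linarith)))⟩
  obtain ⟨s, hs, hlip⟩ := R.lipschitz
  obtain ⟨ρ, hρ, hbox, hslope⟩ : ∃ ρ > 0,
      (∀ q, dist q (b.1, (0 : ℝ)) < ρ → R.sol q ∈ N ∧ q ∈ s ∧
        HasDerivAt (fun t => R.eqn (q.1, t)) (q.2 * R.slope q) q.2 ∧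
        (R.eqn q = 0 → f (q.1, R.sol q) = 0)) ∧
      ((∀ q, dist q (b.1, (0 : ℝ)) < ρ → k < R.slope q) ∨
        ∀ q, dist q (b.1, (0 : ℝ)) < ρ → R.slope q < -k) := by
    have h1 := hsol.and ((show ∀ᶠ q in 𝓝 (b.1, (0 : ℝ)), q ∈ s from hs).and
      (R.hasDerivAt_eqn.and R.zero_of_eqn))
    rcases hslope with h | h
    · obtain ⟨ρ, hρ, h2⟩ := Metric.eventually_nhds_iff.1 (h1.and h)
      exact ⟨ρ, hρ, fun q hq => (h2 hq).1, Or.inl fun q hq => (h2 hq).2⟩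
    · obtain ⟨ρ, hρ, h2⟩ := Metric.eventually_nhds_iff.1 (h1.and h)
      exact ⟨ρ, hρ, fun q hq => (h2 hq).1, Or.inr fun q hq => (h2 hq).2⟩
  obtain ⟨θ, κ, hθ0, hκ0, hθA, hθC, hκC, hκk, hκA⟩ := exists_fold_constants hC hRC hk hA
  refine ⟨κ, hκ0, ?_⟩
  have e1 : ∀ᶠ p in 𝓝 b, dist p.1 b.1 < min ρ 1 :=
    (continuous_fst.tendsto b).eventually (Metric.ball_mem_nhds _ (by positivity))
  have e2 : ∀ᶠ p in 𝓝 b, |R.d p| < ρ / 2 :=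
    R.continuousAt_d.abs.eventually (gt_mem_nhds (by simp [R.d_base, hρ]))
  filter_upwards [e1, e2, R.bound, hS] with p h1 h2 h3 h4 hpX δ hδ hδS hfp
  obtain ⟨h1ρ, h11⟩ := lt_min_iff.1 h1
  -- The base point of the fold is itself degenerate, so `δ` is below the distance to it.
  have hδ1 : δ ≤ 1 := by
    have := hδS _ hbS
    rw [dist_eq_norm] at h11
    linarith
  refine ⟨hδ1, ?_⟩
  set t := R.d p
  obtain ⟨x', hx'S, hx'⟩ := h4 hpX
  -- The residual accounts for at most half of `δ` in the distance estimate, so the degeneracy must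
  -- account for the rest.
  have h5 : δ / 2 ≤ C * t ^ 2 := by
    have h6 := hδS x' hx'S
    have h7 : C * ‖f p‖ ≤ 1 / 2 * δ := by
      calc C * ‖f p‖ ≤ C * (κ * δ) := by gcongr
        _ = C * κ * δ := by ring
        _ ≤ 1 / 2 * δ := by gcongr
    linarith
  have hsq : √δ ^ 2 = δ := Real.sq_sqrt hδ.le
  set τ := θ * √δ with hτ
  have hτ0 : 0 < τ := by positivity
  have hτt : τ ≤ |t| / 2 := by
    refine abs_le_of_sq_le_sq' ?_ (by positivity) |>.2
    rw [hτ, mul_pow, hsq, div_pow, sq_abs]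
    have : θ ^ 2 * δ ≤ 1 / (8 * C) * δ := by gcongr
    have h6 : 1 / (8 * C) * δ ≤ t ^ 2 / 2 ^ 2 := by
      rw [div_mul_eq_mul_div, div_le_div_iff₀ (by positivity) (by positivity)]
      linarith
    linarith
  have hin : ∀ r ∈ Set.Icc (t - τ) (t + τ), dist (p.1, r) (b.1, (0 : ℝ)) < ρ := by
    intro r hr
    rw [Prod.dist_eq, max_lt_iff, Real.dist_eq, sub_zero]
    refine ⟨h1ρ, ?_⟩
    have : |r| ≤ |t| + τ := by
      rw [abs_le]
      constructor <;> linarith [hr.1, hr.2, le_abs_self t, neg_abs_le t]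
    linarith
  have hzero : ∃ r ∈ Set.Icc (t - τ) (t + τ), R.eqn (p.1, r) = 0 := by
    refine exists_zero_of_deriv_bound (φ := fun s => R.eqn (p.1, s))
      (φ' := fun s => s * R.slope (p.1, s)) (k := τ * k) hτ0.le
      (fun r hr => (hbox _ (hin r hr)).2.2.1) ?_ ?_
    · rcases le_total 0 t with ht | ht
      · rw [abs_of_nonneg ht] at hτt
        have hr' : ∀ r ∈ Set.Icc (t - τ) (t + τ), τ ≤ r := fun r hr => by linarith [hr.1]
        rcases hslope with h | h
        · left
          intro r hr
          have := h _ (hin r hr)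
          have := hr' r hr
          nlinarith
        · right
          intro r hr
          have := h _ (hin r hr)
          have := hr' r hr
          nlinarith
      · rw [abs_of_nonpos ht] at hτt
        have hr' : ∀ r ∈ Set.Icc (t - τ) (t + τ), r ≤ -τ := fun r hr => by linarith [hr.2]
        rcases hslope with h | h
        · right
          intro r hr
          have := h _ (hin r hr)
          have := hr' r hr
          nlinarith
        · left
          intro r hr
          have := h _ (hin r hr)
          have := hr' r hr
          nlinarith
    · refine h3.1.trans ?_
      calc R.C * ‖f p‖ ≤ R.C * (κ * δ) := by gcongr
        _ = R.C * κ * δ := by ring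
        _ ≤ k * θ ^ 2 * δ := by gcongr
        _ = τ * k * τ := by rw [hτ]; linear_combination (-k * θ ^ 2) * hsq
  obtain ⟨r, hr, hr0⟩ := hzero
  have hbr := hbox _ (hin r hr)
  refine ⟨R.sol (p.1, r), hbr.1, hbr.2.2.2 hr0, ?_⟩
  have hbt := hbox _ (hin t ⟨by linarith, by linarith⟩)
  have h6 := hlip _ hbt.2.1 _ hbr.2.1
  have h7 : ‖((p.1, t) : E × ℝ) - (p.1, r)‖ ≤ τ := by
    rw [Prod.mk_sub_mk, sub_self, Prod.norm_mk, norm_zero, max_eq_right (norm_nonneg _),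
      Real.norm_eq_abs, abs_le]
    constructor <;> linarith [hr.1, hr.2]
  -- Since `δ ≤ 1`, the error `κ δ` coming from the residual is absorbed into the scale `√δ`.
  have hδs : δ ≤ √δ := Real.le_sqrt_of_sq_le (by nlinarith)
  calc ‖p.2 - R.sol (p.1, r)‖
      = ‖(p.2 - R.sol (p.1, t)) + (R.sol (p.1, t) - R.sol (p.1, r))‖ := by congr 1; abel
    _ ≤ ‖p.2 - R.sol (p.1, t)‖ + ‖R.sol (p.1, t) - R.sol (p.1, r)‖ := norm_add_le _ _
    _ ≤ R.C * (κ * √δ) + R.C * (θ * √δ) := by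
        refine add_le_add (h3.2.trans ?_) (h6.trans ?_)
        · gcongr; exact hfp.trans (by gcongr)
        · gcongr
    _ = (R.C * κ + R.C * θ) * √δ := by ring
    _ ≤ (A / 2 + A / 2) * √δ := by gcongr
    _ = A * √δ := by ring

end Estimates

/-! ### Uniform bounds by compactness -/

section Global

variable {E F : Type*} [NormedAddCommGroup E] [InnerProductSpace ℝ E]
  [NormedAddCommGroup F] [InnerProductSpace ℝ F]
  [FiniteDimensional ℝ E] [FiniteDimensional ℝ F]

/-- Near a nondegenerate zero of the family `f`, zeros are as close as the residual is small. -/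
theorem exists_zero_near_of_injective {f : E × F → F} {b : E × F} (hf : ContDiffAt ℝ 1 f b)
    (hfb : f b = 0) (hinj : ∀ u, partialSnd f b u = 0 → u = 0) {N : Set F} (hN : N ∈ 𝓝 b.2) :
    ∃ C : ℝ, 0 < C ∧ ∀ᶠ p in 𝓝 b, ∃ y ∈ N, f (p.1, y) = 0 ∧ ‖p.2 - y‖ ≤ C * ‖f p‖ := by
  let G : E × F → E × F := fun p => (p.1, f p)
  have hG : ContDiffAt ℝ 1 G b := contDiff_fst.contDiffAt.prodMk hf
  have hG' : ∀ u, fderiv ℝ G b u = (u.1, fderiv ℝ f b u) := by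
    have h1 : HasFDerivAt G _ b := (ContinuousLinearMap.fst ℝ E F).hasFDerivAt.prodMk
      (hf.differentiableAt one_ne_zero).hasFDerivAt
    intro u
    rw [h1.fderiv]
    rfl
  obtain ⟨I, hI, hIb, hGI, hIG, -⟩ := exists_contDiffAt_local_inverse hG (by
    rintro ⟨ξ, η⟩ hu
    rw [hG', Prod.mk_eq_zero] at hu
    obtain ⟨h1, h2⟩ := hu
    simp only at h1
    subst h1
    rw [hinj η h2, Prod.mk_zero_zero])
  have hGb : G b = (b.1, 0) := by simp [G, hfb]
  rw [hGb] at hI hIb hGI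
  obtain ⟨K, s, hs, hK⟩ := hI.exists_lipschitzOnWith
  have t1 : Tendsto G (𝓝 b) (𝓝 (b.1, 0)) := by rw [← hGb]; exact hG.continuousAt.tendsto
  have t2 : Tendsto (fun p : E × F => (p.1, (0 : F))) (𝓝 b) (𝓝 (b.1, 0)) :=
    (continuous_fst.prodMk continuous_const).continuousAt
  have hIN : ∀ᶠ q in 𝓝 (b.1, (0 : F)), (I q).2 ∈ N := by
    have := hI.continuousAt.snd.tendsto
    rw [hIb] at this
    exact this hN
  refine ⟨K + 1, by positivity, ?_⟩
  filter_upwards [t1.eventually hs, t2.eventually hs, t2.eventually hGI, hIG,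
    t2.eventually hIN] with p h1 h2 h3 h4 h5
  have h6 : (I (p.1, 0)).1 = p.1 := (Prod.mk.inj h3).1
  have h7 : f (I (p.1, 0)) = 0 := (Prod.mk.inj h3).2
  have h11 : I (p.1, 0) = (p.1, (I (p.1, 0)).2) := Prod.ext h6 rfl
  refine ⟨(I (p.1, 0)).2, h5, by rw [← h11]; exact h7, ?_⟩
  have h8 := hK.dist_le_mul _ h1 _ h2
  rw [h4, dist_eq_norm, dist_eq_norm] at h8
  have h9 : ‖G p - (p.1, 0)‖ = ‖f p‖ := by simp [G, Prod.norm_def]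
  rw [h9] at h8
  have h10 : ‖p.2 - (I (p.1, 0)).2‖ ≤ ‖p - I (p.1, 0)‖ := norm_snd_le (p - I (p.1, 0))
  nlinarith [norm_nonneg (f p)]

/-- Positive constants that work locally can be chosen uniformly over a compact set. -/
theorem IsCompact.exists_uniform_constants {α : Type*} [TopologicalSpace α] {K : Set α}
    (hK : IsCompact K) {Q : ℝ → ℝ → α → Prop}
    (hmono : ∀ {D₁ D₂ D₁' D₂' a}, D₁' ≤ D₁ → D₂' ≤ D₂ → Q D₁ D₂ a → Q D₁' D₂' a)
    (hloc : ∀ a ∈ K, ∃ D₁ D₂ : ℝ, 0 < D₁ ∧ 0 < D₂ ∧ ∀ᶠ p in 𝓝 a, p ∈ K → Q D₁ D₂ p) :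
    ∃ D₁ D₂ : ℝ, 0 < D₁ ∧ 0 < D₂ ∧ ∀ a ∈ K, Q D₁ D₂ a := by
  refine hK.induction_on (p := fun s => ∃ D₁ D₂ : ℝ, 0 < D₁ ∧ 0 < D₂ ∧ ∀ a ∈ s, Q D₁ D₂ a)
    ⟨1, 1, one_pos, one_pos, by simp⟩ ?_ ?_ ?_
  · rintro s t hst ⟨D₁, D₂, h₁, h₂, h⟩
    exact ⟨D₁, D₂, h₁, h₂, fun a ha => h a (hst ha)⟩
  · rintro s t ⟨D₁, D₂, h₁, h₂, h⟩ ⟨D₁', D₂', h₁', h₂', h'⟩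
    refine ⟨min D₁ D₁', min D₂ D₂', lt_min h₁ h₁', lt_min h₂ h₂', ?_⟩
    rintro a (ha | ha)
    · exact hmono (min_le_left _ _) (min_le_left _ _) (h a ha)
    · exact hmono (min_le_right _ _) (min_le_right _ _) (h' a ha)
  · intro a ha
    obtain ⟨D₁, D₂, h₁, h₂, h⟩ := hloc a ha
    exact ⟨_, eventually_nhdsWithin_iff.2 h, D₁, D₂, h₁, h₂, fun p hp => hp⟩

/-- Every zero of `f` over `X` is nondegenerate or a fold which controls the distance to the
degenerate set. -/
def HasFoldDichotomy (f : E × F → F) (X : Set E) : Prop :=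
  ∀ b, b.1 ∈ X → f b = 0 → (∀ u, partialSnd f b u = 0 → u = 0) ∨
    ∃ (v : F) (R : FoldReduction f b v) (C : ℝ), 0 < C ∧ ∀ᶠ p in 𝓝 b, p.1 ∈ X →
      ∃ x' ∈ degenerateSet f X, ‖p.1 - x'‖ ≤ C * (‖f p‖ + R.d p ^ 2)

omit [FiniteDimensional ℝ E] in
theorem HasFoldDichotomy.exists_eigenvalue_bound {f : E × F → F} {X : Set E} {Y' : Set F}
    (h : HasFoldDichotomy f X) (hf : ∀ b, b.1 ∈ X → ContDiffAt ℝ 2 f b)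
    (hX : IsCompact X) (hY' : IsCompact Y') :
    ∃ D₁ D₂ : ℝ, 0 < D₁ ∧ 0 < D₂ ∧ ∀ p ∈ X ×ˢ Y', f p = 0 → ∀ (l : ℝ) (u : F), u ≠ 0 →
      partialSnd f p u = l • u → ∀ δ : ℝ, 0 < δ →
      (∀ x' ∈ degenerateSet f X, δ < ‖p.1 - x'‖) → min (D₁ * √δ) D₂ ≤ |l| := by
  refine (hX.prod hY').exists_uniform_constants (Q := fun D₁ D₂ p => f p = 0 →
    ∀ (l : ℝ) (u : F), u ≠ 0 → partialSnd f p u = l • u → ∀ δ : ℝ, 0 < δ →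
      (∀ x' ∈ degenerateSet f X, δ < ‖p.1 - x'‖) → min (D₁ * √δ) D₂ ≤ |l|) ?_ ?_
  · intro D₁ D₂ D₁' D₂' a h₁ h₂ hQ hfa l u hu hl δ hδ hδS
    refine le_trans ?_ (hQ hfa l u hu hl δ hδ hδS)
    gcongr
  · rintro b ⟨hbX, -⟩
    by_cases hfb : f b = 0
    · rcases h b hbX hfb with hinj | ⟨v, R, C, hC, hR⟩
      · obtain ⟨c, hc, hcb⟩ := eventually_norm_le_of_injective (hf b hbX).partialSnd.continuousAt
          hinj
        refine ⟨1, c, one_pos, hc, ?_⟩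
        filter_upwards [hcb] with p h1 _ _ l u hu hl δ _ _
        have h2 := h1 u
        rw [hl, norm_smul] at h2
        exact (min_le_right _ _).trans (le_of_mul_le_mul_right h2 (norm_pos_iff.2 hu))
      · have hRC := R.C_pos
        -- At a zero the estimates combine to `δ < C d² ≤ C (R.C |l|)²`, which is solved for `|l|`.
        refine ⟨√(1 / (C * R.C ^ 2)), 1, by positivity, one_pos, ?_⟩
        filter_upwards [hR, R.d_le] with p h1 h2 hp hfp l u hu hl δ hδ hδS
        obtain ⟨x', hx', hle⟩ := h1 hp.1
        have h3 := hδS x' hx'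
        rw [hfp, norm_zero, zero_add] at hle
        have h4 : R.d p ^ 2 ≤ (R.C * |l|) ^ 2 := by
          rw [← sq_abs (R.d p)]
          gcongr
          exact h2 l u hu hl
        refine (min_le_left _ _).trans ?_
        rw [← Real.sqrt_mul (by positivity)]
        refine Real.sqrt_le_iff.2 ⟨abs_nonneg _, ?_⟩
        rw [div_mul_eq_mul_div, div_le_iff₀ (by positivity)]
        have h5 : C * R.d p ^ 2 ≤ C * (R.C * |l|) ^ 2 := by gcongr
        nlinarith
    · refine ⟨1, 1, one_pos, one_pos, ?_⟩
      filter_upwards [(hf b hbX).continuousAt.eventually_ne hfb] with p h1 _ h2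
      exact absurd h2 h1

/-- A small residual would produce a zero too close to the point. The inclusion of `Y` in the
interior of `Y'` ensures that this zero lies in `Y'`, where zeros are excluded. The radius is capped
at `A` because the eigenvalue bound that supplies it saturates for large `δ`. -/
theorem HasFoldDichotomy.exists_residual_bound {f : E × F → F} {X : Set E} {Y Y' : Set F}
    (h : HasFoldDichotomy f X) (hf : ∀ b, b.1 ∈ X → ContDiffAt ℝ 2 f b)
    (hX : IsCompact X) (hY : IsCompact Y) (hYY' : Y ⊆ interior Y') {A : ℝ} (hA : 0 < A) :
    ∃ D₃ D₄ : ℝ, 0 < D₃ ∧ 0 < D₄ ∧ ∀ p ∈ X ×ˢ Y, ∀ δ : ℝ, 0 < δ →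
      (∀ x' ∈ degenerateSet f X, δ < ‖p.1 - x'‖) →
      (∀ y' ∈ Y', f (p.1, y') = 0 → A * min (√δ) 1 < ‖p.2 - y'‖) →
      min (D₃ * δ) D₄ ≤ ‖f p‖ := by
  refine (hX.prod hY).exists_uniform_constants (Q := fun D₃ D₄ p => ∀ δ : ℝ, 0 < δ →
      (∀ x' ∈ degenerateSet f X, δ < ‖p.1 - x'‖) →
      (∀ y' ∈ Y', f (p.1, y') = 0 → A * min (√δ) 1 < ‖p.2 - y'‖) →
      min (D₃ * δ) D₄ ≤ ‖f p‖) ?_ ?_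
  · intro D₁ D₂ D₁' D₂' a h₁ h₂ hQ δ hδ hδS hδY
    refine le_trans ?_ (hQ δ hδ hδS hδY)
    gcongr
  · rintro b ⟨hbX, hbY⟩
    have hN : Y' ∈ 𝓝 b.2 := mem_interior_iff_mem_nhds.1 (hYY' hbY)
    by_cases hfb : f b = 0
    · rcases h b hbX hfb with hinj | ⟨v, R, C, hC, hR⟩
      · obtain ⟨C, hC, hCb⟩ := exists_zero_near_of_injective ((hf b hbX).of_le (by norm_num)) hfb
          hinj hN
        refine ⟨A / C, A / C, by positivity, by positivity, ?_⟩
        filter_upwards [hCb] with p h1 _ δ hδ _ hδY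
        obtain ⟨y, hyY, hy0, hyle⟩ := h1
        have h2 : A * min (√δ) 1 ≤ C * ‖f p‖ := (hδY y hyY hy0).le.trans hyle
        rcases le_total (√δ) 1 with h3 | h3
        · refine (min_le_left _ _).trans ?_
          rw [min_eq_left h3] at h2
          have h4 : δ ≤ √δ := by
            nlinarith [Real.sq_sqrt hδ.le, Real.sqrt_nonneg δ]
          rw [div_mul_eq_mul_div, div_le_iff₀ hC]
          nlinarith
        · refine (min_le_right _ _).trans ?_
          rw [min_eq_right h3] at h2
          rw [div_le_iff₀ hC]
          linarith
      · obtain ⟨κ, hκ, hκb⟩ := R.exists_zero_near hfb hbX hC hR hA hN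
        refine ⟨κ, 1, hκ, one_pos, ?_⟩
        filter_upwards [hκb] with p h1 hp δ hδ hδS hδY
        refine (min_le_left _ _).trans ?_
        by_contra hlt
        obtain ⟨hδ1, y, hyY, hy0, hyle⟩ := h1 hp.1 δ hδ hδS (not_le.1 hlt).le
        have h2 := hδY y hyY hy0
        rw [min_eq_left (Real.sqrt_le_one.2 hδ1)] at h2
        linarith
    · refine ⟨1, ‖f b‖ / 2, one_pos, by positivity, ?_⟩
      have hpos : 0 < ‖f b‖ := norm_pos_iff.2 hfb
      filter_upwards [(hf b hbX).continuousAt.norm.eventually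
        (lt_mem_nhds (show ‖f b‖ / 2 < ‖f b‖ by linarith))] with p h1 _ δ _ _ _
      exact (min_le_right _ _).trans h1.le

end Global

/-! ### Translation between `g` and its partial gradient field -/

section Bridge

open FoldBifurcation

variable {n m : ℕ} {g : EuclideanSpace ℝ (Fin n) → EuclideanSpace ℝ (Fin m) → ℝ}

/-- The partial gradient `∇_y g` as a function on the product. -/
noncomputable def gradField (g : EuclideanSpace ℝ (Fin n) → EuclideanSpace ℝ (Fin m) → ℝ)
    (p : EuclideanSpace ℝ (Fin n) × EuclideanSpace ℝ (Fin m)) : EuclideanSpace ℝ (Fin m) :=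
  gradY g p.1 p.2

theorem contDiffAt_section {k : WithTop ℕ∞} {p : EuclideanSpace ℝ (Fin n) × EuclideanSpace ℝ (Fin m)}
    (hg : ContDiffAt ℝ k (Function.uncurry g) p) : ContDiffAt ℝ k (fun y => g p.1 y) p.2 :=
  ContDiffAt.comp p.2 (g := Function.uncurry g) (f := fun y => (p.1, y)) hg
    (contDiffAt_const.prodMk contDiffAt_id)

theorem gradField_eq {p : EuclideanSpace ℝ (Fin n) × EuclideanSpace ℝ (Fin m)}
    (hg : DifferentiableAt ℝ (Function.uncurry g) p) :
    gradField g p = (InnerProductSpace.toDual ℝ (EuclideanSpace ℝ (Fin m))).symm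
      ((fderiv ℝ (Function.uncurry g) p).comp (ContinuousLinearMap.inr ℝ _ _)) := by
  have h1 : HasFDerivAt (fun y => g p.1 y)
      ((fderiv ℝ (Function.uncurry g) p).comp (ContinuousLinearMap.inr ℝ _ _)) p.2 :=
    HasFDerivAt.comp p.2 (g := Function.uncurry g) (f := fun y => (p.1, y)) hg.hasFDerivAt
      (hasFDerivAt_prodMk_right p.1 p.2)
  rw [gradField, gradY, gradient, h1.fderiv]

theorem contDiffAt_gradField {p : EuclideanSpace ℝ (Fin n) × EuclideanSpace ℝ (Fin m)}
    (hg : ContDiffAt ℝ 3 (Function.uncurry g) p) : ContDiffAt ℝ 2 (gradField g) p := by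
  have h1 : ContDiffAt ℝ 2 (fun q => (InnerProductSpace.toDual ℝ (EuclideanSpace ℝ (Fin m))).symm
      ((fderiv ℝ (Function.uncurry g) q).comp (ContinuousLinearMap.inr ℝ _ _))) p :=
    (InnerProductSpace.toDual ℝ
      (EuclideanSpace ℝ (Fin m))).symm.toContinuousLinearEquiv.contDiff.contDiffAt.comp p
      ((hg.fderiv_right (m := 2) (by norm_num)).clm_comp contDiffAt_const)
  refine h1.congr_of_eventuallyEq ?_
  filter_upwards [hg.eventually (by simp)] with q hq
  exact gradField_eq (hq.differentiableAt (by simp))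

theorem hessYY_eq_partialSnd {p : EuclideanSpace ℝ (Fin n) × EuclideanSpace ℝ (Fin m)}
    (hg : ContDiffAt ℝ 3 (Function.uncurry g) p) :
    hessYY g p.1 p.2 = partialSnd (gradField g) p := by
  have h1 : HasFDerivAt (fun y => gradY g p.1 y) (partialSnd (gradField g) p) p.2 :=
    HasFDerivAt.comp p.2 (g := gradField g) (f := fun y => (p.1, y))
      ((contDiffAt_gradField hg).differentiableAt (by simp)).hasFDerivAt
      (hasFDerivAt_prodMk_right p.1 p.2)
  exact h1.fderiv

theorem inner_hessYY {x : EuclideanSpace ℝ (Fin n)} {y : EuclideanSpace ℝ (Fin m)}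
    (hg : ContDiffAt ℝ 2 (fun y' => g x y') y) (u u' : EuclideanSpace ℝ (Fin m)) :
    inner ℝ (hessYY g x y u) u' = fderiv ℝ (fderiv ℝ (fun y' => g x y')) y u u' := by
  have h1 : DifferentiableAt ℝ (fderiv ℝ (fun y' => g x y')) y :=
    (hg.fderiv_right (m := 1) (by norm_num [one_add_one_eq_two])).differentiableAt one_ne_zero
  have h2 : ContDiffAt ℝ 1 (fun y' => gradY g x y') y :=
    (InnerProductSpace.toDual ℝ
      (EuclideanSpace ℝ (Fin m))).symm.toContinuousLinearEquiv.contDiff.contDiffAt.comp y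
      (hg.fderiv_right (m := 1) (by norm_num [one_add_one_eq_two]))
  have h3 : HasFDerivAt (fun y' => (inner ℝ u' (gradY g x y') : ℝ))
      ((innerSL ℝ u').comp (hessYY g x y)) y :=
    (innerSL ℝ u').hasFDerivAt.comp y (h2.differentiableAt one_ne_zero).hasFDerivAt
  have h4 := h1.hasFDerivAt.clm_apply (hasFDerivAt_const u' y)
  have h5 : (fun y' => (inner ℝ u' (gradY g x y') : ℝ)) =
      fun y' => fderiv ℝ (fun y' => g x y') y' u' := by
    ext y'
    rw [real_inner_comm]
    exact inner_gradient_left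
  rw [h5] at h3
  have h6 := congrArg (fun A => A u) (h3.unique h4)
  rw [real_inner_comm]
  simpa using h6

theorem inner_partialSnd_gradField_comm {p : EuclideanSpace ℝ (Fin n) × EuclideanSpace ℝ (Fin m)}
    (hg : ContDiffAt ℝ 3 (Function.uncurry g) p) (u u' : EuclideanSpace ℝ (Fin m)) :
    inner ℝ (partialSnd (gradField g) p u) u' = inner ℝ u (partialSnd (gradField g) p u') := by
  have h1 : ContDiffAt ℝ 2 (fun y => g p.1 y) p.2 :=
    contDiffAt_section (hg.of_le (by norm_num))
  rw [← hessYY_eq_partialSnd hg, inner_hessYY h1, real_inner_comm, inner_hessYY h1]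
  exact h1.isSymmSndFDerivAt (by simp) u u'

/-- Identifies the derivative of `d` along the kernel direction with the third derivative of `g` in
the fold condition. -/
theorem inner_fderiv_partialSnd_gradField
    {p : EuclideanSpace ℝ (Fin n) × EuclideanSpace ℝ (Fin m)}
    (hg : ContDiffAt ℝ 3 (Function.uncurry g) p) (v : EuclideanSpace ℝ (Fin m)) :
    inner ℝ v (fderiv ℝ (partialSnd (gradField g)) p (0, v) v) =
      iteratedFDeriv ℝ 3 (fun y => g p.1 y) p.2 (fun _ => v) := by
  have hsec : ContDiffAt ℝ 3 (fun y => g p.1 y) p.2 := contDiffAt_section hg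
  have h1 : DifferentiableAt ℝ (iteratedFDeriv ℝ 2 (fun y => g p.1 y)) p.2 :=
    (hsec.iteratedFDeriv_right (m := 1) (i := 2) (by norm_num)).differentiableAt one_ne_zero
  rw [iteratedFDeriv_succ_apply_left,
    ← fderiv_continuousMultilinear_apply_const_apply h1 (Fin.tail fun _ => v)]
  have hι : Tendsto (fun y => (p.1, y)) (𝓝 p.2) (𝓝 p) :=
    (continuous_const.prodMk continuous_id).continuousAt
  have h2 : (fun y => iteratedFDeriv ℝ 2 (fun y => g p.1 y) y (Fin.tail fun _ => v)) =ᶠ[𝓝 p.2]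
      fun y => inner ℝ v (partialSnd (gradField g) (p.1, y) v) := by
    filter_upwards [hι.eventually (hg.eventually (by simp))] with y hy
    rw [iteratedFDeriv_two_apply, ← hessYY_eq_partialSnd hy, real_inner_comm]
    exact (inner_hessYY (contDiffAt_section (p := (p.1, y)) (hy.of_le (by norm_num))) v v).symm
  have h3 : HasFDerivAt (fun y => partialSnd (gradField g) (p.1, y))
      ((fderiv ℝ (partialSnd (gradField g)) p).comp (ContinuousLinearMap.inr ℝ _ _)) p.2 :=
    HasFDerivAt.comp p.2 (g := partialSnd (gradField g)) (f := fun y => (p.1, y))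
      ((contDiffAt_gradField hg).partialSnd.differentiableAt one_ne_zero).hasFDerivAt
      (hasFDerivAt_prodMk_right p.1 p.2)
  have h4 := (innerSL ℝ v).hasFDerivAt.comp p.2 (h3.clm_apply (hasFDerivAt_const v p.2))
  have h5 : HasFDerivAt (fun y => (inner ℝ v (partialSnd (gradField g) (p.1, y) v) : ℝ)) _ p.2 := h4
  rw [h2.fderiv_eq, h5.fderiv]
  simp

theorem inner_crossGrad {p : EuclideanSpace ℝ (Fin n) × EuclideanSpace ℝ (Fin m)}
    (hg : ContDiffAt ℝ 3 (Function.uncurry g) p) (v : EuclideanSpace ℝ (Fin m))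
    (ξ : EuclideanSpace ℝ (Fin n)) :
    inner ℝ (crossGrad g p.1 p.2 v) ξ = inner ℝ v (fderiv ℝ (gradField g) p (ξ, 0)) := by
  have h1 : HasFDerivAt (fun x => gradY g x p.2)
      ((fderiv ℝ (gradField g) p).comp (ContinuousLinearMap.inl ℝ _ _)) p.1 :=
    HasFDerivAt.comp p.1 (g := gradField g) (f := fun x => (x, p.2))
      ((contDiffAt_gradField hg).differentiableAt (by simp)).hasFDerivAt
      (hasFDerivAt_prodMk_left p.1 p.2)
  have h2 : HasFDerivAt (fun x => (inner ℝ v (gradY g x p.2) : ℝ)) _ p.1 :=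
    (innerSL ℝ v).hasFDerivAt.comp p.1 h1
  have h3 : (fun x => (inner ℝ (gradY g x p.2) v : ℝ)) = fun x => inner ℝ v (gradY g x p.2) := by
    ext x
    exact real_inner_comm _ _
  rw [crossGrad, inner_gradient_left, h3, h2.fderiv]
  simp

theorem det_eq_zero_iff_exists_ne_zero {V : Type*} [NormedAddCommGroup V] [NormedSpace ℝ V]
    [FiniteDimensional ℝ V] {T : V →L[ℝ] V} :
    T.det = 0 ↔ ∃ u ≠ 0, T u = 0 := by
  rw [ContinuousLinearMap.det, LinearMap.det_eq_zero_iff_ker_ne_bot, Submodule.ne_bot_iff]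
  constructor
  · rintro ⟨u, hu, hu0⟩
    exact ⟨u, hu0, hu⟩
  · rintro ⟨u, hu0, hu⟩
    exact ⟨u, hu, hu0⟩

theorem isFoldAt_gradField {p : EuclideanSpace ℝ (Fin n) × EuclideanSpace ℝ (Fin m)}
    (hg : ContDiffAt ℝ 3 (Function.uncurry g) p) (h : IsFold g p.1 p.2) :
    ∃ v, ‖v‖ = 1 ∧ hessYY g p.1 p.2 v = 0 ∧ IsFoldAt (gradField g) p v := by
  obtain ⟨⟨u, hu⟩, hu0, hspan⟩ := finrank_eq_one_iff'.1 h.simple_zero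
  have hu0' : u ≠ 0 := fun h0 => hu0 (Subtype.ext h0)
  have hnu : ‖u‖ ≠ 0 := norm_ne_zero_iff.2 hu0'
  have hHu : hessYY g p.1 p.2 u = 0 := hu
  have hv : ‖(‖u‖⁻¹ • u)‖ = 1 := by rw [norm_smul, norm_inv, norm_norm, inv_mul_cancel₀ hnu]
  have hHv : hessYY g p.1 p.2 (‖u‖⁻¹ • u) = 0 := by rw [map_smul, hHu, smul_zero]
  refine ⟨‖u‖⁻¹ • u, hv, hHv, ?_⟩
  exact {
    contDiffAt := contDiffAt_gradField hg
    zero := h.stationary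
    norm_eq := hv
    ker_apply := by rw [← hessYY_eq_partialSnd hg]; exact hHv
    ker_le := by
      intro w hw
      rw [← hessYY_eq_partialSnd hg] at hw
      obtain ⟨c, hc⟩ := hspan ⟨w, hw⟩
      refine ⟨c * ‖u‖, ?_⟩
      rw [smul_smul, mul_assoc, mul_inv_cancel₀ hnu, mul_one]
      exact (congrArg Subtype.val hc).symm
    symm := (hg.eventually (by simp)).mono fun q hq => inner_partialSnd_gradField_comm hq
    third := by
      rw [inner_fderiv_partialSnd_gradField hg]
      exact h.third_ne_zero _ hv hHv }

/-- At an interior point every hyperplane has points of the set strictly on both sides. -/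
theorem exists_inner_neg_pos_of_mem_interior {E : Type*} [NormedAddCommGroup E]
    [InnerProductSpace ℝ E] {X : Set E} {x w : E} (hx : x ∈ interior X) (hw : w ≠ 0) :
    ∃ x₁ ∈ X, ∃ x₂ ∈ X, inner ℝ w (x₁ - x) < (0 : ℝ) ∧ (0 : ℝ) < inner ℝ w (x₂ - x) := by
  have hX : X ∈ 𝓝 x := mem_interior_iff_mem_nhds.1 hx
  have hev : ∀ᶠ t in 𝓝 (0 : ℝ), x + t • w ∈ X := by
    have : Tendsto (fun t : ℝ => x + t • w) (𝓝 0) (𝓝 x) := by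
      have h : Continuous fun t : ℝ => x + t • w := by fun_prop
      simpa using h.tendsto 0
    exact this hX
  obtain ⟨ε, hε, hball⟩ := Metric.eventually_nhds_iff.1 hev
  have hww : (0 : ℝ) < inner ℝ w w := real_inner_self_pos.2 hw
  refine ⟨_, hball (y := -(ε / 2)) ?_, _, hball (y := ε / 2) ?_, ?_, ?_⟩
  · rw [Real.dist_eq, sub_zero, abs_neg, abs_of_pos (by positivity)]; linarith
  · rw [Real.dist_eq, sub_zero, abs_of_pos (by positivity)]; linarith
  · rw [add_sub_cancel_left, inner_smul_right]; nlinarith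
  · rw [add_sub_cancel_left, inner_smul_right]; positivity

theorem degenerateSet_gradField {X : Set (EuclideanSpace ℝ (Fin n))}
    (hg : ∀ p : EuclideanSpace ℝ (Fin n) × EuclideanSpace ℝ (Fin m), p.1 ∈ X →
      ContDiffAt ℝ 3 (Function.uncurry g) p) :
    degenerateSet (gradField g) X = bifurcationSet g X := by
  ext x
  simp only [degenerateSet, bifurcationSet, IsMorse, Set.mem_ofPred_eq, not_forall, not_not,
    exists_prop]
  refine and_congr_right fun hx => exists_congr fun y => and_congr_right fun _ => ?_
  rw [det_eq_zero_iff_exists_ne_zero, hessYY_eq_partialSnd (hg (x, y) hx)]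

theorem hasFoldDichotomy_gradField {X : Set (EuclideanSpace ℝ (Fin n))}
    (hg : ∀ p : EuclideanSpace ℝ (Fin n) × EuclideanSpace ℝ (Fin m), p.1 ∈ X →
      ContDiffAt ℝ 3 (Function.uncurry g) p)
    (hXconv : Convex ℝ X)
    (hfold : ∀ x ∈ X, ∀ y, IsDegenerateStationary g x y → IsFold g x y)
    (htan : ∀ x ∈ frontier X, ∀ y, IsDegenerateStationary g x y → NotTangent g X x y) :
    HasFoldDichotomy (gradField g) X := by
  intro b hbX hb0
  by_cases hdet : (hessYY g b.1 b.2).det = 0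
  · right
    have hdeg : IsDegenerateStationary g b.1 b.2 := ⟨hb0, hdet⟩
    have hfd := hfold b.1 hbX b.2 hdeg
    obtain ⟨v, hv, hHv, hfa⟩ := isFoldAt_gradField (hg b hbX) hfd
    obtain ⟨R⟩ := hfa.nonempty_reduction
    have hT : (∃ x₁ ∈ X, ∃ x₂ ∈ X, inner ℝ (crossGrad g b.1 b.2 v) (x₁ - b.1) < (0 : ℝ) ∧
        (0 : ℝ) < inner ℝ (crossGrad g b.1 b.2 v) (x₂ - b.1)) ∨
        ∃ c : ℝ, 0 < c ∧ ∀ x' ∈ X,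
          c * ‖x' - b.1‖ ≤ |inner ℝ (crossGrad g b.1 b.2 v) (x' - b.1)| := by
      by_cases hfr : b.1 ∈ frontier X
      · exact htan b.1 hfr b.2 hdeg v hv hHv
      · have hint : b.1 ∈ interior X := by
          by_contra h
          exact hfr ⟨subset_closure hbX, h⟩
        -- Over the interior of `X`, `w ≠ 0` already gives points of `X` on both sides, so
        -- non-tangency is an assumption only on the boundary.
        exact Or.inl (exists_inner_neg_pos_of_mem_interior hint (hfd.cross_ne_zero v hv hHv))
    obtain ⟨C, hC, h⟩ := R.exists_degenerate_near hXconv hbX (inner_crossGrad (hg b hbX) v) hT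
    exact ⟨v, R, C, hC, h⟩
  · left
    intro u hu
    by_contra h0
    rw [← hessYY_eq_partialSnd (hg b hbX)] at hu
    exact hdet (det_eq_zero_iff_exists_ne_zero.2 ⟨u, h0, hu⟩)

theorem lt_norm_of_not_mem_bifurcationNhd {X : Set (EuclideanSpace ℝ (Fin n))} {δ : ℝ}
    (hδ : 0 < δ) {x : EuclideanSpace ℝ (Fin n)} (hx : x ∈ X \ bifurcationNhd g X δ)
    {x' : EuclideanSpace ℝ (Fin n)} (hx' : x' ∈ bifurcationSet g X) : δ < ‖x - x'‖ := by
  have h1 : ¬ Metric.infEDist x (bifurcationSet g X) ≤ ENNReal.ofReal δ := fun h =>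
    hx.2 ⟨hx.1, Metric.mem_cthickening_iff.2 h⟩
  have h2 := (not_le.1 h1).trans_le (Metric.infEDist_le_edist_of_mem hx')
  rw [edist_dist, ENNReal.ofReal_lt_ofReal_iff_of_nonneg hδ.le, dist_eq_norm] at h2
  exact h2

theorem ofReal_min_le_mu {X : Set (EuclideanSpace ℝ (Fin n))}
    {Y' : Set (EuclideanSpace ℝ (Fin m))}
    (hg : ∀ p : EuclideanSpace ℝ (Fin n) × EuclideanSpace ℝ (Fin m), p.1 ∈ X →
      ContDiffAt ℝ 3 (Function.uncurry g) p) {D δ : ℝ} (hδ : 0 < δ)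
    (h : ∀ p ∈ X ×ˢ Y', gradField g p = 0 → ∀ (l : ℝ) (u : EuclideanSpace ℝ (Fin m)), u ≠ 0 →
      partialSnd (gradField g) p u = l • u →
      (∀ x' ∈ degenerateSet (gradField g) X, δ < ‖p.1 - x'‖) → D ≤ |l|) :
    ENNReal.ofReal D ≤ mu g X Y' δ := by
  refine le_iInf₂ fun x hx => le_iInf₂ fun y hy => le_iInf₂ fun l hl => ?_
  refine ENNReal.ofReal_le_ofReal ?_
  obtain ⟨u, hu⟩ := hl.exists_hasEigenvector
  refine h (x, y) ⟨hx.1, hy.1⟩ hy.2 l u hu.2 ?_ ?_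
  · rw [← hessYY_eq_partialSnd (hg (x, y) hx.1)]
    exact hu.apply_eq_smul
  · rw [degenerateSet_gradField hg]
    exact fun x' hx' => lt_norm_of_not_mem_bifurcationNhd hδ hx hx'

theorem ofReal_min_le_alpha {X : Set (EuclideanSpace ℝ (Fin n))}
    {Y Y' : Set (EuclideanSpace ℝ (Fin m))}
    (hg : ∀ p : EuclideanSpace ℝ (Fin n) × EuclideanSpace ℝ (Fin m), p.1 ∈ X →
      ContDiffAt ℝ 3 (Function.uncurry g) p) {D δ r : ℝ} (hδ : 0 < δ) (hr : 0 ≤ r) {ρ : ENNReal}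
    (hρ : ENNReal.ofReal r ≤ ρ)
    (h : ∀ p ∈ X ×ˢ Y, (∀ x' ∈ degenerateSet (gradField g) X, δ < ‖p.1 - x'‖) →
      (∀ y' ∈ Y', gradField g (p.1, y') = 0 → r < ‖p.2 - y'‖) → D ≤ ‖gradField g p‖) :
    ENNReal.ofReal D ≤ alpha g X Y Y' δ ρ := by
  refine le_iInf₂ fun x hx => le_iInf₂ fun y hy => ?_
  refine ENNReal.ofReal_le_ofReal ?_
  refine h (x, y) ⟨hx.1, hy.1⟩ ?_ ?_
  · rw [degenerateSet_gradField hg]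
    exact fun x' hx' => lt_norm_of_not_mem_bifurcationNhd hδ hx hx'
  · intro y' hy' h0
    have h1 : ¬ Metric.infEDist y (crit g Y' x) ≤ ρ := hy.2
    have h2 := (hρ.trans_lt (not_le.1 h1)).trans_le
      (Metric.infEDist_le_edist_of_mem (show y' ∈ crit g Y' x from ⟨hy', h0⟩))
    rw [edist_dist, ENNReal.ofReal_lt_ofReal_iff_of_nonneg hr, dist_eq_norm] at h2
    exact h2

end Bridge

end FoldAnalysis

/-! ### Combination of the eigenvalue and residual bounds -/

theorem mainTheorem6 {n m : ℕ}
    (g : EuclideanSpace ℝ (Fin n) → EuclideanSpace ℝ (Fin m) → ℝ)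
    (X : Set (EuclideanSpace ℝ (Fin n))) (Y Y' : Set (EuclideanSpace ℝ (Fin m)))
    (y₀ : EuclideanSpace ℝ (Fin m)) (L₁ L₂ gLow : ℝ)
    -- `g` is smooth on a neighbourhood of `X × ℝᵐ`
    (O : Set (EuclideanSpace ℝ (Fin n) × EuclideanSpace ℝ (Fin m)))
    (hO : IsOpen O) (hXO : X ×ˢ Set.univ ⊆ O)
    (hg : ContDiffOn ℝ ∞ (Function.uncurry g) O)
    (hXconv : Convex ℝ X) (hXcomp : IsCompact X)
    -- the full gradient is `L₁`-Lipschitz, the Hessian in `y` is `L₂`-Lipschitz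
    (hL₁ : ∀ x ∈ X, ∀ x' ∈ X, ∀ y y',
      √(‖FoldBifurcation.gradX g x y - FoldBifurcation.gradX g x' y'‖ ^ 2 +
          ‖FoldBifurcation.gradY g x y - FoldBifurcation.gradY g x' y'‖ ^ 2) ≤
        L₁ * √(‖x - x'‖ ^ 2 + ‖y - y'‖ ^ 2))
    (hL₂pos : 0 < L₂)
    (hL₂ : ∀ x ∈ X, ∀ x' ∈ X, ∀ y y',
      ‖FoldBifurcation.hessYY g x y - FoldBifurcation.hessYY g x' y'‖ ≤
        L₂ * √(‖x - x'‖ ^ 2 + ‖y - y'‖ ^ 2))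
    (hlow : ∀ x ∈ X, ∀ y, gLow ≤ g x y)
    -- the sublevel sets at `y₀` are compact and lie in the compact set `Y`
    (hY : IsCompact Y) (hy₀ : y₀ ∈ Y)
    (hsub : ∀ x ∈ X, IsCompact {y | g x y ≤ g x y₀} ∧ {y | g x y ≤ g x y₀} ⊆ Y)
    (hY' : IsCompact Y') (hYY' : Y ⊆ interior Y')
    -- all degenerate stationary points are fold bifurcation points
    (hfold : ∀ x ∈ X, ∀ y, FoldBifurcation.IsDegenerateStationary g x y →
      FoldBifurcation.IsFold g x y)
    -- over the boundary of `X`, the fold hypersurface is not tangent to `X`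
    (htan : ∀ x ∈ frontier X, ∀ y, FoldBifurcation.IsDegenerateStationary g x y →
      FoldBifurcation.NotTangent g X x y) :
    ∃ D₁ D₂ D₃ D₄ : ℝ, 0 < D₁ ∧ 0 < D₂ ∧ 0 < D₃ ∧ 0 < D₄ ∧
      ∀ δ : ℝ, 0 < δ →
        ENNReal.ofReal (min (D₁ * √δ) D₂) ≤ FoldBifurcation.mu g X Y' δ ∧
        ENNReal.ofReal (min (D₃ * δ) D₄) ≤
          FoldBifurcation.alpha g X Y Y' δ
            (FoldBifurcation.mu g X Y' δ / ENNReal.ofReal (2 * L₂)) := by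
  have hg' : ∀ p : EuclideanSpace ℝ (Fin n) × EuclideanSpace ℝ (Fin m), p.1 ∈ X →
      ContDiffAt ℝ 3 (Function.uncurry g) p := fun p hp =>
    (hg.contDiffAt (hO.mem_nhds (hXO ⟨hp, Set.mem_univ _⟩))).of_le
      (WithTop.coe_le_coe.2 (le_top (a := (3 : ℕ∞))))
  have hf : ∀ p : EuclideanSpace ℝ (Fin n) × EuclideanSpace ℝ (Fin m), p.1 ∈ X →
      ContDiffAt ℝ 2 (gradField g) p := fun p hp => contDiffAt_gradField (hg' p hp)
  have hdich := hasFoldDichotomy_gradField hg' hXconv hfold htan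
  obtain ⟨D₁, D₂, hD₁, hD₂, hmu⟩ := hdich.exists_eigenvalue_bound hf hXcomp hY'
  obtain ⟨D₃, D₄, hD₃, hD₄, halpha⟩ := hdich.exists_residual_bound hf hXcomp hY hYY'
    -- This `A` is chosen so that `A min(√δ, 1) ≤ min(D₁ √δ, D₂) / (2 L₂) ≤ μ(δ) / (2 L₂)`. A point
    -- outside `Crit_r` for the last radius is then farther than `A min(√δ, 1)` from every
    -- stationary point in `Y'`.
    (show 0 < min D₁ D₂ / (2 * L₂) from div_pos (lt_min hD₁ hD₂) (by positivity))
  refine ⟨D₁, D₂, D₃, D₄, hD₁, hD₂, hD₃, hD₄, fun δ hδ => ?_⟩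
  have hmu' : ENNReal.ofReal (min (D₁ * √δ) D₂) ≤ FoldBifurcation.mu g X Y' δ :=
    ofReal_min_le_mu hg' hδ fun p hp h0 l u hu hl hS => hmu p hp h0 l u hu hl δ hδ hS
  refine ⟨hmu', ofReal_min_le_alpha hg' hδ (r := min D₁ D₂ / (2 * L₂) * min (√δ) 1)
    (by positivity) ?_ fun p hp hS hr => halpha p hp δ hδ hS hr⟩
  refine le_trans ?_ (ENNReal.div_le_div_right hmu' _)
  rw [← ENNReal.ofReal_div_of_pos (by positivity)]
  refine ENNReal.ofReal_le_ofReal ?_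
  rw [div_mul_eq_mul_div]
  gcongr
  refine le_min ?_ ?_
  · gcongr
    · exact min_le_left _ _
    · exact min_le_left _ _
  · calc min D₁ D₂ * min (√δ) 1 ≤ D₂ * 1 := by
          gcongr
          · exact min_le_right _ _
          · exact min_le_right _ _
      _ = D₂ := mul_one _
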